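/- Let $B(\ell^2(\mathbb N))$ be the algebra of bounded operators on the complex Hilbert space $\ell^2(\mathbb N)$, with operators identified with their matrices in the canonical orthonormal basis, and let $\mathcal D$ be the subalgebra of diagonal operators. Let $E: B(\ell^2(\mathbb N))\to\mathcal D$ be the conditional expectation that keeps the diagonal entries and replaces the off-diagonal entries by $0$. For $A\subseteq\mathbb N$ let $P_A\in\mathcal D$ be the diagonal projection whose $(i,i)$ entry is $1$ if $i\in A$ and $0$ otherwise. A state is a unital positive linear functional, and a pure state is an extreme point of the set of states. The Kadison–Singer conjecture is the assertion that every pure state on $\mathcal D$ extends uniquely to a state on $B(\ell^2(\mathbb N))$. An $r$-paving of $\mathbb N$ is a collection of disjoint sets $A_1,\dots,A_r$ with $A_1\cup\dots\cup A_r=\mathbb N$. Fix real numbers $0<a<1<b$, and let $\mathcal P[a,b]$ be the set of $P\in B(\ell^2(\mathbb N))$ with $aI\le P\le bI$. **Theorem.** The following are equivalent: (i) the Kadison–Singer conjecture is true; (ii) for each $H=H^*\in B(\ell^2(\mathbb N))$ with $E(H)=0$ and each $\epsilon>0$, there exist an $r$ and an $r$-paving $\{A_1,\dots,A_r\}$ of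 $\mathbb N$ with $-\epsilon P_{A_i}\le P_{A_i}HP_{A_i}\le\epsilon P_{A_i}$ for $i=1,\dots,r$; (iii) for each $\epsilon>0$ there exists an $r$ such that for every $H=H^*\in B(\ell^2(\mathbb N))$ with $E(H)=0$ there exists an $r$-paving $\{A_1,\dots,A_r\}$ of $\mathbb N$ with $\|P_{A_i}HP_{A_i}\|\le\epsilon\|H\|$ for $i=1,\dots,r$; (iv) for each positive invertible $P\in B(\ell^2(\mathbb N))$ and each $\epsilon>0$, there exist an $r$, an $r$-paving $\{A_1,\dots,A_r\}$ of $\mathbb N$ and positive real numbers $c_1,\dots,c_r,d_1,\dots,d_r$ with $c_id_i>1-\epsilon$ such that $c_iP_{A_i}\le P_{A_i}PP_{A_i}$ and $d_iP_{A_i}\le P_{A_i}P^{-1}P_{A_i}$ for $i=1,\dots,r$; (v) for each $P\in\mathcal P[a,b]$ and each $\epsilon>0$, there exist an $r$, an $r$-paving $\{A_1,\dots,A_r\}$ of $\mathbb N$ and positive real numbers $c_1,\dots,c_r,d_1,\dots,d_r$ with $c_id_i>1-\epsilon$ such that $c_iP_{A_i}\le P_{A_i}PP_{A_i}$ and $d_iP_{A_i}\le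 P_{A_i}P^{-1}P_{A_i}$ for $i=1,\dots,r$; (vi) for each $\epsilon>0$ there exists an $r$ such that for every $P\in\mathcal P[a,b]$ there exist an $r$-paving $\{A_1,\dots,A_r\}$ of $\mathbb N$ and positive real numbers $c_1,\dots,c_r,d_1,\dots,d_r$ with $c_id_i>1-\epsilon$ such that $c_iP_{A_i}\le P_{A_i}PP_{A_i}$ and $d_iP_{A_i}\le P_{A_i}P^{-1}P_{A_i}$ for $i=1,\dots,r$. -/

import Mathlib

open scoped ENNReal ComplexOrder

noncomputable section

namespace KadisonSinger

/-- The Hilbert space `ℓ²(ℕ)`. -/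
abbrev H2 : Type := lp (fun _ : ℕ => ℂ) 2

/-- The C*-algebra `B(ℓ²(ℕ))`; its order is the Loewner order. -/
abbrev BH : Type := H2 →L[ℂ] H2

/-- The canonical orthonormal basis vector `e_j`. -/
def e (j : ℕ) : H2 := lp.single 2 j (1 : ℂ)

theorem e_apply_ne {i j : ℕ} (h : i ≠ j) : (e j) i = 0 :=
  lp.single_apply_ne (E := fun _ : ℕ => ℂ) 2 j (1 : ℂ) h

/-- The `(i, j)` entry `⟨e_i, X e_j⟩` of the infinite matrix of `X`. -/
def entry (X : BH) (i j : ℕ) : ℂ := (X (e j)) i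

theorem memlp_mul {d : ℕ → ℂ} {C : ℝ} (hd : ∀ i, ‖d i‖ ≤ C) (x : H2) :
    Memℓp (fun i => d i * x i) 2 := by
  refine memℓp_gen ?_
  have hx := ((lp.memℓp x).summable (by norm_num)).mul_left (C ^ (2 : ℝ))
  refine Summable.of_nonneg_of_le (fun i => by positivity) (fun i => ?_) (by simpa using hx)
  simp only [norm_mul, ENNReal.toReal_ofNat, Real.rpow_ofNat, mul_pow]
  gcongr
  exact hd i

theorem norm_mul_le {d : ℕ → ℂ} {C : ℝ} (hd : ∀ i, ‖d i‖ ≤ C) (x : H2) :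
    ‖(⟨fun i => d i * x i, memlp_mul hd x⟩ : H2)‖ ≤ C * ‖x‖ := by
  have hC : 0 ≤ C := (norm_nonneg _).trans (hd 0)
  have h : ‖(C : ℂ) • x‖ = C * ‖x‖ := by
    rw [norm_smul]; simp [abs_of_nonneg hC]
  rw [← h]
  refine lp.norm_mono (by norm_num) (fun i => ?_)
  simp only [norm_mul, lp.coeFn_smul, Pi.smul_apply, smul_eq_mul, Complex.norm_real,
    Real.norm_eq_abs, abs_of_nonneg hC]
  gcongr
  exact hd i

/-- The diagonal operator `x ↦ (d i * x i)_i` of a bounded sequence `d`. -/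
def diagOp (d : ℕ → ℂ) (hd : ∃ C : ℝ, ∀ i, ‖d i‖ ≤ C) : BH :=
  LinearMap.mkContinuousOfExistsBound
    { toFun := fun x => ⟨fun i => d i * x i, memlp_mul hd.choose_spec x⟩
      map_add' := fun x y => by
        ext i
        exact mul_add _ _ _
      map_smul' := fun c x => by
        ext i
        simp [mul_left_comm] }
    ⟨hd.choose, fun x => norm_mul_le hd.choose_spec x⟩

@[simp]
theorem diagOp_apply (d : ℕ → ℂ) (hd : ∃ C : ℝ, ∀ i, ‖d i‖ ≤ C) (x : H2) (i : ℕ) :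
    (diagOp d hd x) i = d i * x i := rfl

theorem norm_entry_le (X : BH) (i j : ℕ) : ‖entry X i j‖ ≤ ‖X‖ := by
  refine (lp.norm_apply_le_norm (by norm_num) (X (e j)) i).trans ?_
  refine (X.le_opNorm _).trans ?_
  have : ‖e j‖ = 1 := by simp [e]
  simp [this]

theorem entry_eq_inner (X : BH) (i j : ℕ) : entry X i j = inner ℂ (e i) (X (e j)) := by
  simp [entry, e, lp.inner_single_left]

theorem entry_star (X : BH) (i j : ℕ) : entry (star X) i j = star (entry X j i) := by
  rw [entry_eq_inner, entry_eq_inner, ContinuousLinearMap.star_eq_adjoint,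
    ContinuousLinearMap.adjoint_inner_right]
  exact (inner_conj_symm _ _).symm

theorem apply_e_of_diagonal {X : BH} (hX : ∀ i j, i ≠ j → entry X i j = 0) (j : ℕ) :
    X (e j) = entry X j j • e j := by
  ext i
  by_cases h : i = j
  · subst h
    simp [entry, e]
  · have h1 := hX i j h
    have h2 : (e j) i = 0 := e_apply_ne h
    simp only [lp.coeFn_smul, Pi.smul_apply, h2, smul_zero]
    exact h1

/-- The algebra `𝒟` of operators that are diagonal with respect to the canonical basis. -/
def D : StarSubalgebra ℂ BH where
  carrier := {X | ∀ i j, i ≠ j → entry X i j = 0}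
  mul_mem' := by
    intro X Y hX hY i j h
    have h1 : entry (X * Y) i j = entry Y j j * entry X i j := by
      have : (X * Y) (e j) = entry Y j j • X (e j) := by
        rw [mul_apply_eq_comp, apply_e_of_diagonal hY j, map_smul]
      simp [entry, this]
    rw [h1, hX i j h, mul_zero]
  add_mem' := by
    intro X Y hX hY i j h
    have h1 : entry (X + Y) i j = entry X i j + entry Y i j := by simp [entry]
    rw [h1, hX i j h, hY i j h, add_zero]
  algebraMap_mem' := by
    intro c i j h
    have h2 : (e j) i = 0 := e_apply_ne h
    simp [entry, Algebra.algebraMap_eq_smul_one, h2]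
  star_mem' := by
    intro X hX i j h
    rw [entry_star, hX j i h.symm, star_zero]

theorem diagOp_mem (d : ℕ → ℂ) (hd : ∃ C : ℝ, ∀ i, ‖d i‖ ≤ C) : diagOp d hd ∈ D := by
  intro i j h
  have h2 : (e j) i = 0 := e_apply_ne h
  simp [entry, h2]

/-- The conditional expectation `E : B(ℓ²(ℕ)) → 𝒟` that keeps the diagonal entries and replaces
the off-diagonal entries by zero. -/
def E (X : BH) : D :=
  ⟨diagOp (fun i => entry X i i) ⟨‖X‖, fun i => norm_entry_le X i i⟩, diagOp_mem _ _⟩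

open Classical in
/-- The diagonal projection `P_A`, `A ⊆ ℕ`. -/
def proj (A : Set ℕ) : BH :=
  diagOp (fun i => if i ∈ A then 1 else 0) ⟨1, fun i => by split_ifs <;> simp⟩

/-- The states of a unital ordered complex algebra: unital positive linear functionals. Used for
`B(ℓ²(ℕ))` and for `𝒟` with the order inherited from `B(ℓ²(ℕ))`. -/
def states (𝒜 : Type*) [Ring 𝒜] [Algebra ℂ 𝒜] [PartialOrder 𝒜] : Set (𝒜 →ₗ[ℂ] ℂ) :=
  {s | s 1 = 1 ∧ ∀ x : 𝒜, 0 ≤ x → 0 ≤ s x}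

/-- The pure states: the extreme points of the convex set of states. -/
def pureStates (𝒜 : Type*) [Ring 𝒜] [Algebra ℂ 𝒜] [PartialOrder 𝒜] : Set (𝒜 →ₗ[ℂ] ℂ) :=
  (states 𝒜).extremePoints ℝ

/-- The Kadison–Singer conjecture: every pure state on `𝒟` extends uniquely to a state on
`B(ℓ²(ℕ))`. -/
def Conjecture : Prop :=
  ∀ s ∈ pureStates D, ∃! t : BH →ₗ[ℂ] ℂ, t ∈ states BH ∧ ∀ X : D, t (X : BH) = s X

/-- `A_1, …, A_r` is an `r`-paving of `ℕ`: the sets are disjoint and their union is `ℕ`. -/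
def IsPaving {r : ℕ} (A : Fin r → Set ℕ) : Prop :=
  Pairwise (fun i j => Disjoint (A i) (A j)) ∧ ⋃ i, A i = Set.univ

/-- The set `𝒫[a, b]` of operators `P` with `a I ≤ P ≤ b I`. -/
def PInterval (a b : ℝ) : Set BH := {P | a • (1 : BH) ≤ P ∧ P ≤ b • (1 : BH)}

/-- For all `i`, `c_i P_{A_i} ≤ P_{A_i} P P_{A_i}` and `d_i P_{A_i} ≤ P_{A_i} P⁻¹ P_{A_i}` for some
positive reals `c_i, d_i` with `c_i d_i > 1 - ε`. (`Ring.inverse P` is the inverse of an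
invertible `P`.) -/
def PavesPositive {r : ℕ} (A : Fin r → Set ℕ) (P : BH) (ε : ℝ) : Prop :=
  ∃ c d : Fin r → ℝ, ∀ i, 0 < c i ∧ 0 < d i ∧ 1 - ε < c i * d i ∧
    c i • proj (A i) ≤ proj (A i) * P * proj (A i) ∧
    d i • proj (A i) ≤ proj (A i) * Ring.inverse P * proj (A i)

end KadisonSinger

end

noncomputable section

namespace KadisonSinger

/-! ### Coordinates and diagonal operators -/

/-! Statement (ii) is the hub, and every operator inequality is read as an inequality of quadratic
forms on vectors supported in one piece of the paving.

(i) and (ii): a pure state of the diagonal takes only the values 0 and 1 on the projections P_A, so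
it equals 1 on some piece of any paving. If H is small on that piece, so is t(H) for every extension
t; hence the only extension is s ∘ E. Conversely, if H cannot be paved, compactness gives an
ultrafilter U none of whose members carries a small compression of H. A limit of vector states along
U restricts to a pure state of the diagonal but does not vanish at H, although s ∘ E does, so
extension is not unique.

(ii) and (iii), (v) and (vi): if no number of pieces worked uniformly, the direct sum over r of
counterexamples to r-pavings would itself have no paving (`uniform_paving_of_paving`,
`uniform_positive_paving_of_positive_paving`).

(v) gives (ii): apply (v) to P = 1 + tH. The diagonal of P is 1 and that of its inverse is 1 +
O(t²), so cd close to 1 forces c ≥ 1 - tη, which bounds H below by -η on each piece; -H gives the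
upper bound.

(ii) gives (iv): pave the off-diagonal parts of P and of its inverse, and split further until both
diagonals are nearly constant on each piece. Cauchy–Schwarz makes the product of the corresponding
diagonal entries at least 1. -/

theorem memlp_two_iff {f : ℕ → ℂ} : Memℓp f 2 ↔ Summable fun i => ‖f i‖ ^ 2 := by
  rw [memℓp_gen_iff (by norm_num)]
  simp

theorem hasSum_inner_coord (x y : H2) : HasSum (fun i => inner ℂ (x i) (y i)) (inner ℂ x y) :=
  lp.hasSum_inner x y

theorem hasSum_norm_sq (x : H2) : HasSum (fun i => ‖x i‖ ^ 2) (‖x‖ ^ 2) := by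
  simpa using lp.hasSum_norm (p := 2) (by norm_num) x

theorem norm_e (j : ℕ) : ‖e j‖ = 1 := by simp [e]

theorem e_apply_self (j : ℕ) : (e j) j = 1 := by simp [e]

open Classical in
theorem proj_apply (A : Set ℕ) (x : H2) (i : ℕ) :
    (proj A x) i = if i ∈ A then x i else 0 := by
  rw [proj, diagOp_apply]
  by_cases h : i ∈ A <;> simp [h]

theorem diagOp_adjoint (d : ℕ → ℂ) (hd : ∃ C : ℝ, ∀ i, ‖d i‖ ≤ C) (x y : H2) :
    inner ℂ (diagOp d hd x) y =
      inner ℂ x (diagOp (fun i => star (d i)) (by simpa using hd) y) := by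
  have h : ∀ i, inner ℂ (diagOp d hd x i) (y i) =
      inner ℂ (x i) (diagOp (fun i => star (d i)) (by simpa using hd) y i) := fun i => by
    simp only [diagOp_apply, RCLike.inner_apply, map_mul, RCLike.star_def]
    ring
  refine (hasSum_inner_coord _ _).unique ?_
  simp only [h]
  exact hasSum_inner_coord _ _

theorem isSelfAdjoint_diagOp (d : ℕ → ℂ) (hd : ∃ C : ℝ, ∀ i, ‖d i‖ ≤ C)
    (h : ∀ i, star (d i) = d i) : IsSelfAdjoint (diagOp d hd) := by
  rw [ContinuousLinearMap.isSelfAdjoint_iff_isSymmetric]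
  intro x y
  have := diagOp_adjoint d hd x y
  simp only [h] at this
  exact this

theorem isSelfAdjoint_proj (A : Set ℕ) : IsSelfAdjoint (proj A) := by
  refine isSelfAdjoint_diagOp _ _ fun i => ?_
  split_ifs <;> simp

/-! ### The real quadratic form of an operator -/

/-- The real part of the quadratic form of `X`. -/
def quad (X : BH) (x : H2) : ℝ := (inner ℂ (X x) x).re

theorem quad_add (X Y : BH) (x : H2) : quad (X + Y) x = quad X x + quad Y x := by
  simp [quad]

theorem quad_sub (X Y : BH) (x : H2) : quad (X - Y) x = quad X x - quad Y x := by
  simp [quad]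

theorem quad_neg (X : BH) (x : H2) : quad (-X) x = -quad X x := by
  simp [quad, inner_neg_left]

theorem quad_smul (c : ℝ) (X : BH) (x : H2) : quad (c • X) x = c * quad X x := by
  have : (c • X) x = (c : ℂ) • X x := RCLike.real_smul_eq_coe_smul (K := ℂ) c (X x)
  rw [quad, this, inner_smul_left]
  simp [quad]

theorem quad_one (x : H2) : quad 1 x = ‖x‖ ^ 2 := by
  simp only [quad, one_apply_eq_self]
  exact inner_self_eq_norm_sq (𝕜 := ℂ) x

theorem quad_smul_vec (X : BH) (c : ℂ) (x : H2) : quad X (c • x) = ‖c‖ ^ 2 * quad X x :=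
  X.reApplyInnerSelf_smul x

theorem abs_quad_le (X : BH) (x : H2) : |quad X x| ≤ ‖X‖ * ‖x‖ ^ 2 := by
  refine (Complex.abs_re_le_norm _).trans ((norm_inner_le_norm _ _).trans ?_)
  rw [sq, ← mul_assoc]
  gcongr
  exact X.le_opNorm x

theorem quad_e (X : BH) (i : ℕ) : quad X (e i) = (entry X i i).re := by
  rw [entry_eq_inner, ← inner_conj_symm, Complex.conj_re]
  rfl

theorem nonneg_iff_quad {X : BH} : 0 ≤ X ↔ IsSelfAdjoint X ∧ ∀ x, 0 ≤ quad X x := by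
  rw [ContinuousLinearMap.nonneg_iff_isPositive, ContinuousLinearMap.isPositive_def']
  rfl

theorem le_iff_quad {X Y : BH} (hX : IsSelfAdjoint X) (hY : IsSelfAdjoint Y) :
    X ≤ Y ↔ ∀ x, quad X x ≤ quad Y x := by
  rw [← sub_nonneg, nonneg_iff_quad]
  simp [quad_sub, hY.sub hX]

theorem norm_le_of_abs_quad_le {X : BH} (hX : IsSelfAdjoint X) {C : ℝ} (hC : 0 ≤ C)
    (h : ∀ x, |quad X x| ≤ C * ‖x‖ ^ 2) : ‖X‖ ≤ C := by
  rw [ContinuousLinearMap.norm_eq_iSup_rayleighQuotient X hX.isSymmetric]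
  refine ciSup_le fun x => ?_
  rw [ContinuousLinearMap.rayleighQuotient, abs_div, abs_of_nonneg (sq_nonneg ‖x‖)]
  exact div_le_of_le_mul₀ (sq_nonneg _) hC (h x)

/-! ### Vectors supported on a subset of `ℕ` -/

/-- `x` vanishes off `A`. -/
def SupportedOn (A : Set ℕ) (x : H2) : Prop := ∀ i ∉ A, x i = 0

theorem SupportedOn.mono {A B : Set ℕ} (h : A ⊆ B) {x : H2} (hx : SupportedOn A x) :
    SupportedOn B x := fun i hi => hx i fun hA => hi (h hA)

theorem SupportedOn.smul {A : Set ℕ} {x : H2} (hx : SupportedOn A x) (c : ℂ) :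
    SupportedOn A (c • x) := fun i hi => by simp [hx i hi]

theorem supportedOn_e {A : Set ℕ} {i : ℕ} (hi : i ∈ A) : SupportedOn A (e i) :=
  fun _ hj => e_apply_ne fun h => hj (h ▸ hi)

theorem supportedOn_proj (A : Set ℕ) (x : H2) : SupportedOn A (proj A x) :=
  fun i hi => by simp [proj_apply, hi]

theorem SupportedOn.proj_eq {A : Set ℕ} {x : H2} (hx : SupportedOn A x) : proj A x = x := by
  ext i
  rw [proj_apply]
  split_ifs with h
  · rfl
  · exact (hx i h).symm

theorem quad_compress (A : Set ℕ) (X : BH) (x : H2) :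
    quad (proj A * X * proj A) x = quad X (proj A x) := by
  have h := (isSelfAdjoint_proj A).isSymmetric (X (proj A x)) x
  exact congrArg Complex.re h

theorem proj_mul_self (A : Set ℕ) : proj A * proj A = proj A := by
  ext x i
  exact congrArg (fun y : H2 => y i) (supportedOn_proj A x).proj_eq

theorem quad_proj (A : Set ℕ) (x : H2) : quad (proj A) x = ‖proj A x‖ ^ 2 := by
  rw [← quad_one, ← quad_compress, mul_one, proj_mul_self]

theorem isSelfAdjoint_compress {X : BH} (hX : IsSelfAdjoint X) (A : Set ℕ) :
    IsSelfAdjoint (proj A * X * proj A) := by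
  have := hX.conjugate (proj A)
  rwa [(isSelfAdjoint_proj A).star_eq] at this

theorem norm_proj_apply_le (A : Set ℕ) (x : H2) : ‖proj A x‖ ≤ ‖x‖ := by
  refine lp.norm_mono (by norm_num) fun i => ?_
  rw [proj_apply]
  split_ifs <;> simp

theorem isSelfAdjoint_real_smul {X : BH} (hX : IsSelfAdjoint X) (c : ℝ) :
    IsSelfAdjoint (c • X) := by
  rw [RCLike.real_smul_eq_coe_smul (K := ℂ) c X]
  exact IsSelfAdjoint.smul (Complex.conj_ofReal c) hX

/-- The form of the compression at x is the form of X at P_A x, so only vectors supported on A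
matter. -/
theorem smul_proj_le_compress_iff {X : BH} (hX : IsSelfAdjoint X) (A : Set ℕ) (c : ℝ) :
    c • proj A ≤ proj A * X * proj A ↔ ∀ x, SupportedOn A x → c * ‖x‖ ^ 2 ≤ quad X x := by
  rw [le_iff_quad (isSelfAdjoint_real_smul (isSelfAdjoint_proj A) c) (isSelfAdjoint_compress hX A)]
  simp only [quad_smul, quad_proj, quad_compress]
  refine ⟨fun h x hx => ?_, fun h x => h _ (supportedOn_proj A x)⟩
  have := h x
  rwa [hx.proj_eq] at this

theorem compress_le_smul_proj_iff {X : BH} (hX : IsSelfAdjoint X) (A : Set ℕ) (c : ℝ) :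
    proj A * X * proj A ≤ c • proj A ↔ ∀ x, SupportedOn A x → quad X x ≤ c * ‖x‖ ^ 2 := by
  rw [le_iff_quad (isSelfAdjoint_compress hX A) (isSelfAdjoint_real_smul (isSelfAdjoint_proj A) c)]
  simp only [quad_smul, quad_proj, quad_compress]
  refine ⟨fun h x hx => ?_, fun h x => h _ (supportedOn_proj A x)⟩
  have := h x
  rwa [hx.proj_eq] at this

/-- The compression of `X` to `A` has quadratic form bounded by `ε`. -/
def SmallOn (X : BH) (ε : ℝ) (A : Set ℕ) : Prop :=
  ∀ x, SupportedOn A x → |quad X x| ≤ ε * ‖x‖ ^ 2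

theorem SmallOn.mono {X : BH} {ε : ℝ} {A B : Set ℕ} (h : A ⊆ B) (hB : SmallOn X ε B) :
    SmallOn X ε A := fun x hx => hB x (hx.mono h)

theorem smallOn_iff {X : BH} (hX : IsSelfAdjoint X) (ε : ℝ) (A : Set ℕ) :
    (-(ε • proj A) ≤ proj A * X * proj A ∧ proj A * X * proj A ≤ ε • proj A) ↔
      SmallOn X ε A := by
  rw [← neg_smul, smul_proj_le_compress_iff hX, compress_le_smul_proj_iff hX, ← forall₂_and]
  simp only [SmallOn, abs_le, neg_mul]

theorem SmallOn.norm_compress_le {X : BH} (hX : IsSelfAdjoint X) {ε : ℝ} (hε : 0 ≤ ε) {A : Set ℕ}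
    (h : SmallOn X ε A) : ‖proj A * X * proj A‖ ≤ ε := by
  refine norm_le_of_abs_quad_le (isSelfAdjoint_compress hX A) hε fun x => ?_
  rw [quad_compress]
  refine (h _ (supportedOn_proj A x)).trans ?_
  gcongr
  exact norm_proj_apply_le A x

theorem smallOn_of_norm_compress_le {X : BH} {ε : ℝ} {A : Set ℕ}
    (h : ‖proj A * X * proj A‖ ≤ ε) : SmallOn X ε A := by
  intro x hx
  rw [← hx.proj_eq, ← quad_compress, hx.proj_eq]
  exact (abs_quad_le _ _).trans (by gcongr)

theorem smul_norm_sq_le_quad_diagOp {d : ℕ → ℂ} {hd : ∃ C : ℝ, ∀ i, ‖d i‖ ≤ C} {A : Set ℕ} {m : ℝ}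
    (h : ∀ i ∈ A, m ≤ (d i).re) {x : H2} (hx : SupportedOn A x) :
    m * ‖x‖ ^ 2 ≤ quad (diagOp d hd) x := by
  refine hasSum_le (fun i => ?_) ((hasSum_norm_sq x).mul_left m)
    (Complex.hasSum_re (hasSum_inner_coord (diagOp d hd x) x))
  have h1 : (inner ℂ ((diagOp d hd x) i) (x i)).re = (d i).re * ‖x i‖ ^ 2 := by
    have h2 := inner_self_eq_norm_sq_to_K (𝕜 := ℂ) (x i)
    rw [diagOp_apply, ← smul_eq_mul, inner_smul_left, h2, ← RCLike.ofReal_pow]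
    exact (Complex.re_mul_ofReal _ _).trans (by rw [Complex.conj_re]; rfl)
  rw [h1]
  by_cases hi : i ∈ A
  · gcongr
    exact h i hi
  · simp [hx i hi]

/-! ### Pavings -/

/-- Pavings are built as fibres of finite colorings; empty pieces are allowed, so the coloring need
not be surjective. -/
theorem exists_paving_of_coloring {ι : Type*} [Finite ι] (f : ℕ → ι) :
    ∃ (r : ℕ) (A : Fin r → Set ℕ), IsPaving A ∧ ∀ i, ∃ j, A i = f ⁻¹' {j} := by
  obtain ⟨r, ⟨φ⟩⟩ := Finite.exists_equiv_fin ι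
  refine ⟨r, fun i => f ⁻¹' {φ.symm i}, ⟨fun i j hij => ?_, ?_⟩, fun i => ⟨_, rfl⟩⟩
  · refine Set.disjoint_left.2 fun n hi hj => hij ?_
    exact φ.symm.injective (hi.symm.trans hj)
  · refine Set.eq_univ_of_forall fun n => Set.mem_iUnion.2 ⟨φ (f n), by simp⟩

theorem exists_coloring_of_iUnion_eq_univ {ι : Type*} {A : ι → Set ℕ} (hA : ⋃ i, A i = Set.univ) :
    ∃ f : ℕ → ι, ∀ i, f ⁻¹' {i} ⊆ A i := by
  have h : ∀ n, ∃ i, n ∈ A i := fun n => Set.mem_iUnion.1 (hA ▸ Set.mem_univ n)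
  choose f hf using h
  exact ⟨f, fun i n hn => by obtain rfl : f n = i := hn; exact hf n⟩

/-! ### Countable direct sums of operators -/

/-- The `k`-th slice of `x` under the pairing bijection `ℕ × ℕ ≃ ℕ`. -/
def slice (k : ℕ) (x : H2) : H2 :=
  ⟨fun n => x (Nat.pair k n), memlp_two_iff.2 <|
    (hasSum_norm_sq x).summable.comp_injective fun _ _ h => (Nat.pair_eq_pair.1 h).2⟩

@[simp]
theorem slice_apply (k : ℕ) (x : H2) (n : ℕ) : slice k x n = x (Nat.pair k n) := rfl

theorem slice_ext {x y : H2} (h : ∀ k, slice k x = slice k y) : x = y := by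
  ext m
  have := congrArg (fun z : H2 => z m.unpair.2) (h m.unpair.1)
  simpa using this

theorem slice_add (k : ℕ) (x y : H2) : slice k (x + y) = slice k x + slice k y := rfl

theorem slice_smul (k : ℕ) (c : ℂ) (x : H2) : slice k (c • x) = c • slice k x := rfl

theorem hasSum_inner_slice (x y : H2) :
    HasSum (fun k => inner ℂ (slice k x) (slice k y)) (inner ℂ x y) := by
  have h := Nat.pairEquiv.hasSum_iff.2 (hasSum_inner_coord x y)
  exact h.prod_fiberwise fun k => hasSum_inner_coord (slice k x) (slice k y)

theorem hasSum_norm_sq_slice (x : H2) : HasSum (fun k => ‖slice k x‖ ^ 2) (‖x‖ ^ 2) := by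
  have h := Nat.pairEquiv.hasSum_iff.2 (hasSum_norm_sq x)
  exact h.prod_fiberwise fun k => hasSum_norm_sq (slice k x)

/-- The vector with prescribed slices. -/
def ofSlices (f : ℕ → H2) (hf : Summable fun k => ‖f k‖ ^ 2) : H2 :=
  ⟨fun m => f m.unpair.1 m.unpair.2, memlp_two_iff.2 <| by
    refine Nat.pairEquiv.summable_iff.1 ((summable_prod_of_nonneg fun _ => sq_nonneg _).2 ⟨?_, ?_⟩)
    · intro k
      simpa using (hasSum_norm_sq (f k)).summable
    · convert hf using 2 with k
      simpa using (hasSum_norm_sq (f k)).tsum_eq⟩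

@[simp]
theorem slice_ofSlices (f : ℕ → H2) (hf : Summable fun k => ‖f k‖ ^ 2) (k : ℕ) :
    slice k (ofSlices f hf) = f k := by
  ext n
  simp [ofSlices]

theorem summable_norm_sq_single (k : ℕ) (y : H2) :
    Summable fun j => ‖(Pi.single k y : ℕ → H2) j‖ ^ 2 :=
  summable_of_ne_finset_zero (s := {k}) fun j hj => by
    rw [Pi.single_eq_of_ne (by simpa using hj)]
    simp

/-- The vector whose `k`-th slice is `y` and whose other slices vanish. -/
def embed (k : ℕ) (y : H2) : H2 := ofSlices (Pi.single k y) (summable_norm_sq_single k y)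

theorem slice_embed (k : ℕ) (y : H2) (j : ℕ) :
    slice j (embed k y) = (Pi.single k y : ℕ → H2) j := slice_ofSlices _ _ _

theorem inner_embed (k : ℕ) (x y : H2) : inner ℂ (embed k x) (embed k y) = inner ℂ x y := by
  have h := hasSum_single (f := fun j => inner ℂ (slice j (embed k x)) (slice j (embed k y))) k
    fun j hj => by simp [slice_embed, Pi.single_eq_of_ne hj]
  simpa [slice_embed] using (hasSum_inner_slice _ _).unique h

theorem norm_embed (k : ℕ) (y : H2) : ‖embed k y‖ = ‖y‖ := by
  have := congrArg Complex.re (inner_embed k y y)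
  rw [← sq_eq_sq₀ (norm_nonneg _) (norm_nonneg _)]
  rwa [← inner_self_eq_norm_sq (𝕜 := ℂ), ← inner_self_eq_norm_sq (𝕜 := ℂ)]

theorem SupportedOn.embed {A : Set ℕ} {k : ℕ} {y : H2}
    (hy : SupportedOn (Nat.pair k ⁻¹' A) y) : SupportedOn A (embed k y) := by
  intro m hm
  have h : KadisonSinger.embed k y m = slice m.unpair.1 (KadisonSinger.embed k y) m.unpair.2 := by
    simp
  rw [h, slice_embed]
  by_cases hk : m.unpair.1 = k
  · rw [hk, Pi.single_eq_same]
    refine hy _ ?_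
    rw [Set.mem_preimage, ← hk, Nat.pair_unpair]
    exact hm
  · simp [Pi.single_eq_of_ne hk]

section DirectSum

variable {X : ℕ → BH} {C : ℝ}

theorem norm_sq_apply_slice_le (hX : ∀ k, ‖X k‖ ≤ C) (x : H2) (k : ℕ) :
    ‖X k (slice k x)‖ ^ 2 ≤ C ^ 2 * ‖slice k x‖ ^ 2 := by
  rw [← mul_pow]
  gcongr
  exact (X k).le_of_opNorm_le (hX k) _

theorem summable_norm_sq_apply_slice (hX : ∀ k, ‖X k‖ ≤ C) (x : H2) :
    Summable fun k => ‖X k (slice k x)‖ ^ 2 :=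
  Summable.of_nonneg_of_le (fun _ => by positivity) (norm_sq_apply_slice_le hX x)
    ((hasSum_norm_sq_slice x).summable.mul_left _)

/-- The direct sum of a uniformly bounded sequence of operators. -/
def directSum (X : ℕ → BH) (hX : ∀ k, ‖X k‖ ≤ C) : BH :=
  LinearMap.mkContinuous
    { toFun := fun x => ofSlices (fun k => X k (slice k x)) (summable_norm_sq_apply_slice hX x)
      map_add' := fun x y => slice_ext fun k => by simp [slice_add]
      map_smul' := fun c x => slice_ext fun k => by simp [slice_smul] }
    C fun x => by
      have hC : 0 ≤ C := (norm_nonneg _).trans (hX 0)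
      rw [← sq_le_sq₀ (norm_nonneg _) (by positivity), mul_pow]
      refine hasSum_le (fun k => ?_) (hasSum_norm_sq_slice _)
        ((hasSum_norm_sq_slice x).mul_left (C ^ 2))
      simpa using norm_sq_apply_slice_le hX x k

@[simp]
theorem slice_directSum (hX : ∀ k, ‖X k‖ ≤ C) (x : H2) (k : ℕ) :
    slice k (directSum X hX x) = X k (slice k x) :=
  slice_ofSlices (fun k => X k (slice k x)) (summable_norm_sq_apply_slice hX x) k

theorem directSum_embed (hX : ∀ k, ‖X k‖ ≤ C) (k : ℕ) (y : H2) :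
    directSum X hX (embed k y) = embed k (X k y) := by
  refine slice_ext fun j => ?_
  rw [slice_directSum, slice_embed, slice_embed]
  by_cases h : j = k
  · subst h; simp
  · simp [Pi.single_eq_of_ne h]

theorem quad_directSum_embed (hX : ∀ k, ‖X k‖ ≤ C) (k : ℕ) (y : H2) :
    quad (directSum X hX) (embed k y) = quad (X k) y := by
  rw [quad, directSum_embed, inner_embed, quad]

theorem isSelfAdjoint_directSum (hX : ∀ k, ‖X k‖ ≤ C) (h : ∀ k, IsSelfAdjoint (X k)) :
    IsSelfAdjoint (directSum X hX) := by
  rw [ContinuousLinearMap.isSelfAdjoint_iff_isSymmetric]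
  intro x y
  have hk : ∀ k, inner ℂ (slice k (directSum X hX x)) (slice k y) =
      inner ℂ (slice k x) (slice k (directSum X hX y)) := fun k => by
    rw [slice_directSum, slice_directSum]
    exact (h k).isSymmetric _ _
  have hx := hasSum_inner_slice (directSum X hX x) y
  simp only [hk] at hx
  exact hx.unique (hasSum_inner_slice _ _)

theorem hasSum_quad_directSum (hX : ∀ k, ‖X k‖ ≤ C) (x : H2) :
    HasSum (fun k => quad (X k) (slice k x)) (quad (directSum X hX) x) := by
  have := Complex.hasSum_re (hasSum_inner_slice (directSum X hX x) x)
  simp only [slice_directSum] at this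
  exact this

theorem directSum_mul {Y : ℕ → BH} {C' : ℝ} (hX : ∀ k, ‖X k‖ ≤ C) (hY : ∀ k, ‖Y k‖ ≤ C')
    (h : ∀ k, X k * Y k = 1) : directSum X hX * directSum Y hY = 1 := by
  refine ContinuousLinearMap.ext fun x => slice_ext fun k => ?_
  have := congrArg (fun T : BH => T (slice k x)) (h k)
  simpa using this

theorem e_eq_embed (m : ℕ) : e m = embed m.unpair.1 (e m.unpair.2) := by
  ext j
  have h : embed m.unpair.1 (e m.unpair.2) j =
      slice j.unpair.1 (embed m.unpair.1 (e m.unpair.2)) j.unpair.2 := by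
    simp
  rw [h, slice_embed]
  by_cases hjm : j = m
  · subst hjm
    simp [e_apply_self]
  · rw [e_apply_ne hjm]
    by_cases h1 : j.unpair.1 = m.unpair.1
    · rw [h1, Pi.single_eq_same, e_apply_ne]
      intro h2
      apply hjm
      rw [← Nat.pair_unpair j, ← Nat.pair_unpair m, h1, h2]
    · simp [Pi.single_eq_of_ne h1]

theorem entry_directSum_self (hX : ∀ k, ‖X k‖ ≤ C) (m : ℕ) :
    entry (directSum X hX) m m = entry (X m.unpair.1) m.unpair.2 m.unpair.2 := by
  rw [entry_eq_inner, entry_eq_inner, e_eq_embed, directSum_embed, inner_embed]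

end DirectSum

/-! ### Uniform paving of operators with zero diagonal -/

theorem E_eq_zero_iff {X : BH} : E X = 0 ↔ ∀ i, entry X i i = 0 := by
  refine ⟨fun h i => ?_, fun h => ?_⟩
  · have h1 := congrArg (fun Y : D => entry (Y : BH) i i) h
    simpa [E, entry, e_apply_self] using h1
  · refine Subtype.ext (ContinuousLinearMap.ext fun x => lp.ext (funext fun i => ?_))
    have : ((E X : BH) x) i = entry X i i * x i := rfl
    rw [this, h i, zero_mul]
    rfl

theorem entry_smul_real (c : ℝ) (X : BH) (i j : ℕ) : entry (c • X) i j = c * entry X i j := by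
  rw [RCLike.real_smul_eq_coe_smul (K := ℂ) c X]
  rfl

theorem IsPaving.preimage {r : ℕ} {A : Fin r → Set ℕ} (hA : IsPaving A) (f : ℕ → ℕ) :
    IsPaving fun i => f ⁻¹' A i :=
  ⟨fun _ _ hij => (hA.1 hij).preimage f, by rw [← Set.preimage_iUnion, hA.2, Set.preimage_univ]⟩

/-- Diagonal argument: a paving of the direct sum of all counterexamples pulls back to a paving of
each summand with the same number of pieces. -/
theorem uniform_paving_of_paving
    (h : ∀ H : BH, IsSelfAdjoint H → E H = 0 → ∀ ε : ℝ, 0 < ε →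
      ∃ (r : ℕ) (A : Fin r → Set ℕ), IsPaving A ∧ ∀ i, SmallOn H ε (A i))
    {ε : ℝ} (hε : 0 < ε) :
    ∃ r : ℕ, ∀ H : BH, IsSelfAdjoint H → E H = 0 →
      ∃ A : Fin r → Set ℕ, IsPaving A ∧ ∀ i, SmallOn H (ε * ‖H‖) (A i) := by
  by_contra! hcon
  choose H hH hE hbad using hcon
  -- Normalizing makes the sequence uniformly bounded; if `H k = 0` the scaled operator is 0 as
  -- well.
  have hX : ∀ k, ‖‖H k‖⁻¹ • H k‖ ≤ 1 := fun k => by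
    rw [norm_smul, norm_inv, norm_norm]
    exact inv_mul_le_one
  obtain ⟨r, A, hA, hsmall⟩ := h (directSum (fun k => ‖H k‖⁻¹ • H k) hX)
    (isSelfAdjoint_directSum hX fun k => isSelfAdjoint_real_smul (hH k) _)
    (E_eq_zero_iff.2 fun m => by
      rw [entry_directSum_self, entry_smul_real, E_eq_zero_iff.1 (hE _), mul_zero]) ε hε
  -- The summand to look at is the one whose index is the number of pieces just obtained.
  obtain ⟨i, hi⟩ := hbad r _ (hA.preimage (Nat.pair r))
  refine hi fun y hy => ?_
  have h1 := hsmall i _ hy.embed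
  rw [quad_directSum_embed, norm_embed] at h1
  have h2 : quad (H r) y = ‖H r‖ * quad (‖H r‖⁻¹ • H r) y := by
    by_cases h0 : H r = 0
    · simp [h0, quad]
    · rw [quad_smul, mul_inv_cancel_left₀ (norm_ne_zero_iff.2 h0)]
  rw [h2, abs_mul, abs_norm, mul_right_comm, mul_comm]
  gcongr

/-! ### Positive invertible operators -/

theorem isSelfAdjoint_of_nonneg {P : BH} (hP : 0 ≤ P) : IsSelfAdjoint P :=
  (nonneg_iff_quad.1 hP).1

theorem isSelfAdjoint_inverse {P : BH} (hP : IsSelfAdjoint P) :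
    IsSelfAdjoint (Ring.inverse P) := by
  rw [isSelfAdjoint_iff, ← Ring.inverse_star, hP.star_eq]

theorem apply_inverse_apply {P : BH} (hu : IsUnit P) (x : H2) : P (Ring.inverse P x) = x :=
  congrArg (fun T : BH => T x) (Ring.mul_inverse_cancel P hu)

theorem pavesPositive_iff {r : ℕ} {A : Fin r → Set ℕ} {P : BH} (hP : IsSelfAdjoint P) {ε : ℝ} :
    PavesPositive A P ε ↔ ∀ i, ∃ c d : ℝ, 0 < c ∧ 0 < d ∧ 1 - ε < c * d ∧
      (∀ x, SupportedOn (A i) x → c * ‖x‖ ^ 2 ≤ quad P x) ∧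
      ∀ x, SupportedOn (A i) x → d * ‖x‖ ^ 2 ≤ quad (Ring.inverse P) x := by
  simp only [PavesPositive, smul_proj_le_compress_iff hP,
    smul_proj_le_compress_iff (isSelfAdjoint_inverse hP)]
  refine ⟨fun ⟨c, d, h⟩ i => ⟨c i, d i, h i⟩, fun h => ?_⟩
  choose c d h using h
  exact ⟨c, d, h⟩

theorem mem_PInterval_iff {a b : ℝ} {P : BH} : P ∈ PInterval a b ↔
    IsSelfAdjoint P ∧ ∀ x, a * ‖x‖ ^ 2 ≤ quad P x ∧ quad P x ≤ b * ‖x‖ ^ 2 := by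
  have h1 : ∀ c : ℝ, IsSelfAdjoint (c • (1 : BH)) := isSelfAdjoint_real_smul (.one _)
  have key : IsSelfAdjoint P → (P ∈ PInterval a b ↔
      ∀ x, a * ‖x‖ ^ 2 ≤ quad P x ∧ quad P x ≤ b * ‖x‖ ^ 2) := fun hP => by
    simp only [PInterval, Set.mem_ofPred_eq, le_iff_quad (h1 _) hP, le_iff_quad hP (h1 _),
      quad_smul, quad_one, forall_and]
  refine ⟨fun h => ?_, fun h => (key h.1).2 h.2⟩
  have hP : IsSelfAdjoint P := by
    have := (isSelfAdjoint_of_nonneg (sub_nonneg.2 h.1)).add (h1 a)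
    rwa [sub_add_cancel] at this
  exact ⟨hP, (key hP).1 h⟩

theorem isUnit_of_mem_PInterval {a b : ℝ} (ha : 0 < a) {P : BH} (hP : P ∈ PInterval a b) :
    IsUnit P := by
  refine P.isUnit_of_forall_le_norm_inner_map (c := ⟨a, ha.le⟩) ha fun x => ?_
  rw [mul_comm]
  exact ((mem_PInterval_iff.1 hP).2 x).1.trans (Complex.re_le_norm _)

theorem norm_le_of_mem_PInterval {a b : ℝ} (ha : 0 < a) (hb : 0 ≤ b) {P : BH}
    (hP : P ∈ PInterval a b) : ‖P‖ ≤ b := by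
  rw [mem_PInterval_iff] at hP
  refine norm_le_of_abs_quad_le hP.1 hb fun x => abs_le.2 ⟨?_, (hP.2 x).2⟩
  refine le_trans ?_ (hP.2 x).1
  nlinarith [sq_nonneg ‖x‖]

/-- With y = P⁻¹x, a‖y‖² ≤ ⟨Py, y⟩ = ⟨x, y⟩ ≤ ‖x‖‖y‖. -/
theorem norm_inverse_apply_le {a b : ℝ} (ha : 0 < a) {P : BH} (hP : P ∈ PInterval a b) (x : H2) :
    ‖Ring.inverse P x‖ ≤ a⁻¹ * ‖x‖ := by
  have hu := isUnit_of_mem_PInterval ha hP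
  set y := Ring.inverse P x with hy
  have h1 := ((mem_PInterval_iff.1 hP).2 y).1
  have h2 : quad P y ≤ ‖x‖ * ‖y‖ := by
    rw [quad, hy, apply_inverse_apply hu]
    exact (Complex.re_le_norm _).trans (norm_inner_le_norm _ _)
  rw [inv_mul_eq_div, le_div_iff₀ ha]
  by_contra! h3
  have h4 : 0 < ‖y‖ := by
    by_contra! h5
    have : ‖y‖ = 0 := le_antisymm h5 (norm_nonneg _)
    rw [this, zero_mul] at h3
    exact absurd h3 (not_lt.2 (norm_nonneg _))
  nlinarith

/-- The same diagonal argument; the inverses are bounded by 1/a, so their direct sum exists and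
inverts the direct sum of the operators. -/
theorem uniform_positive_paving_of_positive_paving {a b : ℝ} (ha : 0 < a) (hb : 0 ≤ b)
    {ε : ℝ} (h : ∀ P ∈ PInterval a b, ∃ (r : ℕ) (A : Fin r → Set ℕ),
      IsPaving A ∧ PavesPositive A P ε) :
    ∃ r : ℕ, ∀ P ∈ PInterval a b, ∃ A : Fin r → Set ℕ, IsPaving A ∧ PavesPositive A P ε := by
  by_contra! hcon
  choose P hP hbad using hcon
  have hsa := fun k => (mem_PInterval_iff.1 (hP k)).1
  have hu := fun k => isUnit_of_mem_PInterval ha (hP k)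
  have hX : ∀ k, ‖P k‖ ≤ b := fun k => norm_le_of_mem_PInterval ha hb (hP k)
  have hY : ∀ k, ‖Ring.inverse (P k)‖ ≤ a⁻¹ := fun k =>
    ContinuousLinearMap.opNorm_le_bound _ (by positivity) (norm_inverse_apply_le ha (hP k))
  have hS := isSelfAdjoint_directSum hX hsa
  have hinv : Ring.inverse (directSum P hX) = directSum (fun k => Ring.inverse (P k)) hY :=
    Ring.inverse_unit ⟨directSum P hX, directSum (fun k => Ring.inverse (P k)) hY,
      directSum_mul _ _ fun k => Ring.mul_inverse_cancel _ (hu k),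
      directSum_mul _ _ fun k => Ring.inverse_mul_cancel _ (hu k)⟩
  have hmem : directSum P hX ∈ PInterval a b := by
    refine mem_PInterval_iff.2 ⟨hS, fun x => ⟨?_, ?_⟩⟩
    · exact hasSum_le (fun k => ((mem_PInterval_iff.1 (hP k)).2 _).1)
        ((hasSum_norm_sq_slice x).mul_left a) (hasSum_quad_directSum hX x)
    · exact hasSum_le (fun k => ((mem_PInterval_iff.1 (hP k)).2 _).2)
        (hasSum_quad_directSum hX x) ((hasSum_norm_sq_slice x).mul_left b)
  obtain ⟨r, A, hA, hpos⟩ := h _ hmem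
  refine hbad r _ (hA.preimage (Nat.pair r)) ((pavesPositive_iff (hsa r)).2 fun i => ?_)
  obtain ⟨c, d, hc, hd, hcd, h1, h2⟩ := (pavesPositive_iff hS).1 hpos i
  rw [hinv] at h2
  refine ⟨c, d, hc, hd, hcd, fun y hy => ?_, fun y hy => ?_⟩
  · simpa only [norm_embed, quad_directSum_embed] using h1 _ hy.embed
  · simpa only [norm_embed, quad_directSum_embed] using h2 _ hy.embed

/-! ### From positive invertible operators to operators with zero diagonal -/

theorem entry_one_self (i : ℕ) : entry 1 i i = 1 := by
  simp [entry, e_apply_self]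

/-- With y = P⁻¹e_i one has y = e_i - tHy. Substituting this twice, the first-order term vanishes
because ⟨He_i, e_i⟩ = 0. What remains is t²⟨Hy, He_i⟩, where ‖y‖ ≤ 1/a. -/
theorem quad_inverse_one_add_smul_le {a b : ℝ} (ha : 0 < a) {H : BH} (hH : IsSelfAdjoint H) {t : ℝ}
    (hP : 1 + t • H ∈ PInterval a b) {i : ℕ} (hi : entry H i i = 0) :
    quad (Ring.inverse (1 + t • H)) (e i) ≤ 1 + t ^ 2 * (‖H‖ ^ 2 / a) := by
  set y := Ring.inverse (1 + t • H) (e i) with hy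
  have hsm : ∀ z, (t • H) z = (t : ℂ) • H z :=
    fun z => RCLike.real_smul_eq_coe_smul (K := ℂ) t (H z)
  have hyn : ‖y‖ ≤ a⁻¹ := by simpa [norm_e] using norm_inverse_apply_le ha hP (e i)
  have hPy : y + (t : ℂ) • H y = e i := by
    have := apply_inverse_apply (isUnit_of_mem_PInterval ha hP) (e i)
    rw [← hy, add_apply, hsm] at this
    exact this
  have hHe : inner ℂ (H (e i)) (e i) = 0 := by
    rw [← inner_conj_symm, ← entry_eq_inner, hi, map_zero]
  have hsym : ∀ u v, inner ℂ (H u) v = inner ℂ u (H v) := hH.isSymmetric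
  have h1 : inner ℂ (H y) (e i) = -(t : ℂ) * inner ℂ (H y) (H (e i)) := by
    have hyy : y = e i - (t : ℂ) • H y := by rw [← hPy, add_sub_cancel_right]
    calc inner ℂ (H y) (e i) = inner ℂ y (H (e i)) := hsym _ _
      _ = inner ℂ (e i - (t : ℂ) • H y) (H (e i)) := by rw [← hyy]
      _ = -(t : ℂ) * inner ℂ (H y) (H (e i)) := by
        rw [inner_sub_left, ← hsym, hHe, inner_smul_left, Complex.conj_ofReal]
        ring
  have h2 : inner ℂ y (e i) = 1 + (t : ℂ) ^ 2 * inner ℂ (H y) (H (e i)) := by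
    have hyy : y = e i - (t : ℂ) • H y := by rw [← hPy, add_sub_cancel_right]
    calc inner ℂ y (e i) = inner ℂ (e i - (t : ℂ) • H y) (e i) := by rw [← hyy]
      _ = _ := by
        rw [inner_sub_left, inner_smul_left, h1, inner_self_eq_norm_sq_to_K, norm_e,
          Complex.conj_ofReal]
        push_cast
        ring
  have h3 : quad (Ring.inverse (1 + t • H)) (e i) = 1 + t ^ 2 * (inner ℂ (H y) (H (e i))).re := by
    rw [quad, ← hy, h2, ← Complex.ofReal_pow, Complex.add_re, Complex.re_ofReal_mul,
      Complex.one_re]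
  rw [h3]
  gcongr
  calc (inner ℂ (H y) (H (e i))).re ≤ ‖H y‖ * ‖H (e i)‖ :=
        (Complex.re_le_norm _).trans (norm_inner_le_norm _ _)
    _ ≤ (‖H‖ * a⁻¹) * (‖H‖ * 1) := by
        gcongr
        · exact H.le_opNorm_of_le hyn
        · exact H.le_opNorm_of_le (norm_e i).le
    _ = ‖H‖ ^ 2 / a := by rw [div_eq_mul_inv]; ring

theorem exists_paving_quad_lower_bound {a b : ℝ} (ha : 0 < a) (ha1 : a < 1) (hb : 1 < b)
    (h : ∀ P ∈ PInterval a b, ∀ ε : ℝ, 0 < ε →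
      ∃ (r : ℕ) (A : Fin r → Set ℕ), IsPaving A ∧ PavesPositive A P ε)
    {H : BH} (hH : IsSelfAdjoint H) (hE : E H = 0) {η : ℝ} (hη : 0 < η) :
    ∃ (r : ℕ) (A : Fin r → Set ℕ), IsPaving A ∧
      ∀ i x, SupportedOn (A i) x → -η * ‖x‖ ^ 2 ≤ quad H x := by
  obtain ⟨M, hM0, hM⟩ : ∃ M, 0 < M ∧ ‖H‖ ≤ M := ⟨‖H‖ + 1, by positivity, by linarith⟩
  -- The first two bounds put 1 + tH in the interval; the third makes the second-order term of the
  -- inverse at most tη/2.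
  obtain ⟨t, ht, ht1, ht2, ht3⟩ : ∃ t : ℝ, 0 < t ∧ t * M ≤ 1 - a ∧ t * M ≤ b - 1 ∧
      t * (M ^ 2 / a) ≤ η / 2 := by
    refine ⟨min ((1 - a) / M) (min ((b - 1) / M) (η / 2 / (M ^ 2 / a))), ?_, ?_, ?_, ?_⟩
    · have := sub_pos.2 ha1
      have := sub_pos.2 hb
      positivity
    · rw [← le_div_iff₀ hM0]; exact min_le_left _ _
    · rw [← le_div_iff₀ hM0]; exact (min_le_right _ _).trans (min_le_left _ _)
    · rw [← le_div_iff₀ (by positivity)]; exact (min_le_right _ _).trans (min_le_right _ _)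
  have hP : 1 + t • H ∈ PInterval a b := by
    refine mem_PInterval_iff.2 ⟨(IsSelfAdjoint.one _).add (isSelfAdjoint_real_smul hH t), fun x => ?_⟩
    rw [quad_add, quad_one, quad_smul]
    have h1 : |t * quad H x| ≤ t * M * ‖x‖ ^ 2 := by
      rw [abs_mul, abs_of_pos ht, mul_assoc]
      gcongr
      exact (abs_quad_le H x).trans (by gcongr)
    have h2 := abs_le.1 h1
    have h3 := sq_nonneg ‖x‖
    constructor <;> nlinarith
  obtain ⟨r, A, hA, hpos⟩ := h _ hP (t * η / 2) (by positivity)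
  refine ⟨r, A, hA, fun i x hx => ?_⟩
  obtain ⟨c, d, hc, hd, hcd, h1, h2⟩ := (pavesPositive_iff (mem_PInterval_iff.1 hP).1).1 hpos i
  rcases (A i).eq_empty_or_nonempty with hemp | ⟨j, hj⟩
  · have : x = 0 := lp.ext (funext fun n => hx n (by simp [hemp]))
    simp [this, quad]
  · have hj0 := E_eq_zero_iff.1 hE j
    have hc1 : c ≤ 1 := by
      have := h1 _ (supportedOn_e hj)
      rw [quad_add, quad_one, quad_smul, quad_e, hj0, norm_e] at this
      simpa using this
    have hd1 : d ≤ 1 + t * (η / 2) := by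
      have h3 := (h2 _ (supportedOn_e hj)).trans (quad_inverse_one_add_smul_le ha hH hP hj0)
      rw [norm_e, one_pow, mul_one] at h3
      refine h3.trans ?_
      rw [sq t, mul_assoc]
      gcongr
      refine le_trans ?_ ht3
      gcongr
    -- With s = tη/2: 1 - s < cd ≤ c(1 + s) ≤ c + s, the last step using c ≤ 1.
    have hc2 : 1 - t * η ≤ c := by
      have : 0 < t * (η / 2) := by positivity
      nlinarith
    have h4 := h1 x hx
    rw [quad_add, quad_one, quad_smul] at h4
    have h5 : t * (-η * ‖x‖ ^ 2) ≤ t * quad H x := by nlinarith [sq_nonneg ‖x‖]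
    exact le_of_mul_le_mul_left h5 ht

theorem exists_common_refinement {r s : ℕ} {A : Fin r → Set ℕ} {B : Fin s → Set ℕ}
    (hA : IsPaving A) (hB : IsPaving B) :
    ∃ (q : ℕ) (C : Fin q → Set ℕ), IsPaving C ∧ ∀ k, ∃ i j, C k ⊆ A i ∧ C k ⊆ B j := by
  obtain ⟨f, hf⟩ := exists_coloring_of_iUnion_eq_univ hA.2
  obtain ⟨g, hg⟩ := exists_coloring_of_iUnion_eq_univ hB.2
  obtain ⟨q, C, hC, hfib⟩ := exists_paving_of_coloring fun n => (f n, g n)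
  refine ⟨q, C, hC, fun k => ?_⟩
  obtain ⟨⟨i, j⟩, h⟩ := hfib k
  refine ⟨i, j, fun n hn => hf i ?_, fun n hn => hg j ?_⟩ <;>
  · rw [h] at hn
    simp_all

theorem paving_of_positive_paving {a b : ℝ} (ha : 0 < a) (ha1 : a < 1) (hb : 1 < b)
    (h : ∀ P ∈ PInterval a b, ∀ ε : ℝ, 0 < ε →
      ∃ (r : ℕ) (A : Fin r → Set ℕ), IsPaving A ∧ PavesPositive A P ε)
    {H : BH} (hH : IsSelfAdjoint H) (hE : E H = 0) {ε : ℝ} (hε : 0 < ε) :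
    ∃ (r : ℕ) (A : Fin r → Set ℕ), IsPaving A ∧ ∀ i, SmallOn H ε (A i) := by
  obtain ⟨r, A, hA, h1⟩ := exists_paving_quad_lower_bound ha ha1 hb h hH hE hε
  have hE' : E (-H) = 0 := E_eq_zero_iff.2 fun i => by
    have := E_eq_zero_iff.1 hE i
    simpa [entry] using this
  obtain ⟨s, B, hB, h2⟩ := exists_paving_quad_lower_bound ha ha1 hb h hH.neg hE' hε
  obtain ⟨q, C, hC, h3⟩ := exists_common_refinement hA hB
  refine ⟨q, C, hC, fun k x hx => ?_⟩
  obtain ⟨i, j, hi, hj⟩ := h3 k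
  have h4 := h1 i x (hx.mono hi)
  have h5 := h2 j x (hx.mono hj)
  rw [quad_neg] at h5
  exact abs_le.2 ⟨by linarith, by linarith⟩

/-! ### From operators with zero diagonal to positive invertible operators -/

theorem quad_inverse {P : BH} (hu : IsUnit P) (x : H2) :
    quad (Ring.inverse P) x = quad P (Ring.inverse P x) := by
  rw [quad, quad, apply_inverse_apply hu, ← inner_conj_symm, Complex.conj_re]

/-- Cauchy–Schwarz for the form of P at e_i and P⁻¹e_i, proved through the discriminant of the form
along e_i - tP⁻¹e_i. -/
theorem one_le_quad_mul_quad_inverse {P : BH} (hP : 0 ≤ P) (hu : IsUnit P) (i : ℕ) :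
    1 ≤ quad P (e i) * quad (Ring.inverse P) (e i) := by
  obtain ⟨hsa, hpos⟩ := nonneg_iff_quad.1 hP
  have hsym : ∀ u v, inner ℂ (P u) v = inner ℂ u (P v) := hsa.isSymmetric
  set y := Ring.inverse P (e i) with hy
  have hPy : P y = e i := apply_inverse_apply hu _
  have hee : inner ℂ (e i) (e i) = (1 : ℂ) := by
    rw [inner_self_eq_norm_sq_to_K, norm_e]; simp
  have key : ∀ t : ℝ, 0 ≤ quad (Ring.inverse P) (e i) * (t * t) + (-2) * t + quad P (e i) := by
    intro t
    have h := hpos (e i - (t : ℂ) • y)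
    have : quad P (e i - (t : ℂ) • y) =
        quad (Ring.inverse P) (e i) * (t * t) + (-2) * t + quad P (e i) := by
      rw [quad_inverse hu, ← hy, quad, quad, quad, map_sub, map_smul, hPy, inner_sub_left,
        inner_sub_right, inner_sub_right, inner_smul_left, inner_smul_left, inner_smul_right,
        inner_smul_right, hsym, hsym (e i) y, hPy, hee, Complex.conj_ofReal]
      simp
      ring
    rwa [this] at h
  have := discrim_le_zero key
  rw [discrim] at this
  linarith

theorem entry_self_real {X : BH} (hX : IsSelfAdjoint X) (j : ℕ) :
    star (entry X j j) = entry X j j := by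
  rw [← entry_star, hX.star_eq]

theorem coe_E (X : BH) : (E X : BH) =
    diagOp (fun i => entry X i i) ⟨‖X‖, fun i => norm_entry_le X i i⟩ := rfl

theorem isSelfAdjoint_coe_E {X : BH} (hX : IsSelfAdjoint X) : IsSelfAdjoint (E X : BH) := by
  rw [coe_E]
  exact isSelfAdjoint_diagOp _ _ fun j => entry_self_real hX j

theorem entry_coe_E_self (X : BH) (j : ℕ) : entry (E X : BH) j j = entry X j j := by
  simp [E, entry, e_apply_self]

theorem E_sub_coe_E (X : BH) : E (X - E X) = 0 := E_eq_zero_iff.2 fun j => by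
  have := entry_coe_E_self X j
  have h2 : entry (X - E X) j j = entry X j j - entry (E X : BH) j j := rfl
  rw [h2, this, sub_self]

/-- Half of δ pays for the paved off-diagonal part X - E(X), the other half for the oscillation of
the diagonal on a piece. The diagonal is bounded, so finitely many classes of width δ/2 suffice. -/
theorem exists_paving_quad_ge
    (h : ∀ H : BH, IsSelfAdjoint H → E H = 0 → ∀ ε : ℝ, 0 < ε →
      ∃ (r : ℕ) (A : Fin r → Set ℕ), IsPaving A ∧ ∀ i, SmallOn H ε (A i))
    {X : BH} (hX : IsSelfAdjoint X) {δ : ℝ} (hδ : 0 < δ) :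
    ∃ (r : ℕ) (A : Fin r → Set ℕ), IsPaving A ∧ ∀ i, ∀ j ∈ A i, ∀ x, SupportedOn (A i) x →
      (quad X (e j) - δ) * ‖x‖ ^ 2 ≤ quad X x := by
  obtain ⟨r, A, hA, hsmall⟩ := h (X - E X) (hX.sub (isSelfAdjoint_coe_E hX)) (E_sub_coe_E X)
    (δ / 2) (half_pos hδ)
  obtain ⟨f, hf⟩ := exists_coloring_of_iUnion_eq_univ hA.2
  have hbound : ∀ j, |quad X (e j)| ≤ ‖X‖ := fun j => by
    simpa [norm_e] using abs_quad_le X (e j)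
  have hfloor : ∀ j, ⌊quad X (e j) / (δ / 2)⌋ ∈
      Set.Icc ⌊-‖X‖ / (δ / 2)⌋ ⌊‖X‖ / (δ / 2)⌋ := fun j => by
    have := abs_le.1 (hbound j)
    constructor <;> gcongr
    exacts [this.1, this.2]
  obtain ⟨q, B, hB, hfib⟩ := exists_paving_of_coloring fun j => (f j,
    (⟨_, hfloor j⟩ : Set.Icc ⌊-‖X‖ / (δ / 2)⌋ ⌊‖X‖ / (δ / 2)⌋))
  refine ⟨q, B, hB, fun k j hj x hx => ?_⟩
  obtain ⟨⟨i, m⟩, hBk⟩ := hfib k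
  have hmem : ∀ n ∈ B k, f n = i ∧ ⌊quad X (e n) / (δ / 2)⌋ = m := fun n hn => by
    rw [hBk] at hn
    obtain ⟨h1, h2⟩ := Prod.ext_iff.1 (show (_, _) = _ from hn)
    exact ⟨h1, congrArg Subtype.val h2⟩
  have h1 : (quad X (e j) - δ / 2) * ‖x‖ ^ 2 ≤ quad (E X : BH) x := by
    rw [coe_E]
    refine smul_norm_sq_le_quad_diagOp (A := B k) (fun n hn => ?_) hx
    rw [← quad_e]
    have h3 := Int.abs_sub_lt_one_of_floor_eq_floor ((hmem j hj).2.trans (hmem n hn).2.symm)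
    rw [← sub_div, abs_div, abs_of_pos (half_pos hδ), div_lt_one (half_pos hδ)] at h3
    linarith [(abs_lt.1 h3).2]
  have h2 := (abs_le.1 (hsmall i x (hx.mono fun n hn => hf i (hmem n hn).1))).1
  rw [quad_sub] at h2
  linarith

theorem positive_paving_of_paving
    (h : ∀ H : BH, IsSelfAdjoint H → E H = 0 → ∀ ε : ℝ, 0 < ε →
      ∃ (r : ℕ) (A : Fin r → Set ℕ), IsPaving A ∧ ∀ i, SmallOn H ε (A i))
    {P : BH} (hP : 0 ≤ P) (hu : IsUnit P) {ε : ℝ} (hε : 0 < ε) :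
    ∃ (r : ℕ) (A : Fin r → Set ℕ), IsPaving A ∧ PavesPositive A P ε := by
  have hsa := isSelfAdjoint_of_nonneg hP
  obtain ⟨M, hM0, hPM, hQM⟩ : ∃ M : ℝ, 0 < M ∧ ‖P‖ ≤ M ∧ ‖Ring.inverse P‖ ≤ M :=
    ⟨‖P‖ + ‖Ring.inverse P‖ + 1, by positivity, by linarith [norm_nonneg (Ring.inverse P)],
      by linarith [norm_nonneg P]⟩
  -- Let p, q ≤ M be the diagonal entries of P and its inverse, with pq ≥ 1. Then p, q ≥ 1/M > δ,
  -- and (p - δ)(q - δ) ≥ 1 - 2Mδ > 1 - ε.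
  obtain ⟨δ, hδ, hδ1, hδε⟩ : ∃ δ : ℝ, 0 < δ ∧ δ * M < 1 ∧ 2 * M * δ < ε := by
    refine ⟨min (1 / (2 * M)) (ε / (4 * M)), by positivity, ?_, ?_⟩
    · calc _ ≤ 1 / (2 * M) * M := by gcongr; exact min_le_left _ _
        _ < 1 := by field_simp; norm_num
    · calc _ ≤ 2 * M * (ε / (4 * M)) := by gcongr; exact min_le_right _ _
        _ < ε := by field_simp; linarith
  obtain ⟨r, A, hA, h1⟩ := exists_paving_quad_ge h hsa hδ
  obtain ⟨s, B, hB, h2⟩ := exists_paving_quad_ge h (isSelfAdjoint_inverse hsa) hδ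
  obtain ⟨q, C, hC, h3⟩ := exists_common_refinement hA hB
  refine ⟨q, C, hC, (pavesPositive_iff hsa).2 fun k => ?_⟩
  rcases (C k).eq_empty_or_nonempty with hemp | ⟨n, hn⟩
  · refine ⟨1, 1, one_pos, one_pos, by linarith, ?_, ?_⟩ <;>
    · intro x hx
      have : x = 0 := lp.ext (funext fun n => hx n (by simp [hemp]))
      simp [this, quad]
  · obtain ⟨i, j, hi, hj⟩ := h3 k
    have hpq := one_le_quad_mul_quad_inverse hP hu n
    have hp := (abs_quad_le P (e n)).trans' (le_abs_self _)
    have hq := (abs_quad_le (Ring.inverse P) (e n)).trans' (le_abs_self _)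
    have hp0 := (nonneg_iff_quad.1 hP).2 (e n)
    have hq0 : 0 ≤ quad (Ring.inverse P) (e n) := by
      rw [quad_inverse hu]
      exact (nonneg_iff_quad.1 hP).2 _
    rw [norm_e, one_pow, mul_one] at hp hq
    refine ⟨quad P (e n) - δ, quad (Ring.inverse P) (e n) - δ, ?_, ?_, ?_,
      fun x hx => h1 i n (hi hn) x (hx.mono hi), fun x hx => h2 j n (hj hn) x (hx.mono hj)⟩
    · nlinarith
    · nlinarith
    · nlinarith

/-! ### States on `B(ℓ²(ℕ))` and on the diagonal -/

theorem apply_coord_eq_inner (x : H2) (i : ℕ) : x i = inner ℂ (e i) x := by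
  simp [e, lp.inner_single_left]

theorem E_coe (X : D) : E (X : BH) = X := by
  refine Subtype.ext (ContinuousLinearMap.ext fun x => lp.ext (funext fun i => ?_))
  have h1 : star (X : BH) (e i) = entry (star (X : BH)) i i • e i :=
    apply_e_of_diagonal (D.star_mem' X.2) i
  have h2 : ((X : BH) x) i = entry (X : BH) i i * x i := by
    rw [apply_coord_eq_inner, ← ContinuousLinearMap.adjoint_inner_left,
      ← ContinuousLinearMap.star_eq_adjoint, h1, inner_smul_left, ← apply_coord_eq_inner,
      entry_star, RCLike.star_def, Complex.conj_conj]
  exact h2.symm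

theorem D_ext {X Y : D} (h : ∀ i, entry (X : BH) i i = entry (Y : BH) i i) : X = Y := by
  rw [← E_coe X, ← E_coe Y]
  refine Subtype.ext (ContinuousLinearMap.ext fun x => lp.ext (funext fun i => ?_))
  exact congrArg (· * x i) (h i)

/-- The conditional expectation as a linear map. -/
def linearE : BH →ₗ[ℂ] D where
  toFun := E
  map_add' X Y := D_ext fun i => by
    rw [entry_coe_E_self]
    have h : entry ((E X + E Y : D) : BH) i i = entry (E X : BH) i i + entry (E Y : BH) i i := rfl
    rw [h, entry_coe_E_self, entry_coe_E_self]
    rfl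
  map_smul' c X := D_ext fun i => by
    rw [entry_coe_E_self]
    have h : entry ((c • E X : D) : BH) i i = c * entry (E X : BH) i i := rfl
    rw [RingHom.id_apply, h, entry_coe_E_self]
    rfl

theorem linearE_apply (X : BH) : linearE X = E X := rfl

theorem E_nonneg {X : BH} (hX : 0 ≤ X) : 0 ≤ E X := by
  change (0 : BH) ≤ (E X : BH)
  rw [nonneg_iff_quad] at hX ⊢
  refine ⟨isSelfAdjoint_coe_E hX.1, fun x => ?_⟩
  have h := smul_norm_sq_le_quad_diagOp (d := fun i => entry X i i)
    (hd := ⟨‖X‖, fun i => norm_entry_le X i i⟩) (A := Set.univ) (m := 0)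
    (fun i _ => by rw [← quad_e]; exact hX.2 _) (x := x) fun i hi => absurd (Set.mem_univ i) hi
  rwa [zero_mul] at h

theorem comp_linearE_mem_states {s : D →ₗ[ℂ] ℂ} (hs : s ∈ states D) :
    s ∘ₗ linearE ∈ states BH := by
  refine ⟨?_, fun X hX => hs.2 _ (E_nonneg hX)⟩
  have : linearE 1 = 1 := E_coe 1
  rw [LinearMap.comp_apply, this, hs.1]

theorem linearMap_ext_selfAdjoint {𝒜 : Type*} [Ring 𝒜] [StarRing 𝒜] [Algebra ℂ 𝒜]
    [StarModule ℂ 𝒜] {f g : 𝒜 →ₗ[ℂ] ℂ} (h : ∀ x, IsSelfAdjoint x → f x = g x) : f = g := by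
  ext x
  rw [← realPart_add_I_smul_imaginaryPart x, map_add, map_add, map_smul, map_smul,
    h _ (realPart x).2, h _ (imaginaryPart x).2]

/-- The diagonal projection as an element of the diagonal. -/
def projD (A : Set ℕ) : D := ⟨proj A, diagOp_mem _ _⟩

theorem coe_projD (A : Set ℕ) : (projD A : BH) = proj A := rfl

open Classical in
theorem entry_proj (A : Set ℕ) (i : ℕ) : entry (proj A) i i = if i ∈ A then 1 else 0 := by
  rw [entry, proj_apply, e_apply_self]

theorem proj_nonneg (A : Set ℕ) : 0 ≤ proj A :=
  nonneg_iff_quad.2 ⟨isSelfAdjoint_proj A, fun x => by rw [quad_proj]; positivity⟩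

theorem projD_nonneg (A : Set ℕ) : 0 ≤ projD A := proj_nonneg A

theorem projD_compl (A : Set ℕ) : projD Aᶜ = 1 - projD A := D_ext fun i => by
  have h : entry ((1 - projD A : D) : BH) i i = entry 1 i i - entry (proj A) i i := rfl
  rw [h, coe_projD, entry_proj, entry_proj, entry_one_self]
  by_cases hi : i ∈ A <;> simp [hi]

theorem proj_compl (A : Set ℕ) : proj Aᶜ = 1 - proj A :=
  congrArg (fun X : D => (X : BH)) (projD_compl A)

/-- Split x into its parts u on A and v off A. Young's inequality bounds the cross term by ε‖u‖² +
(‖H‖²/ε)‖v‖², which accounts for the second ε. A state equal to 1 on P_A kills the term on the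
complement, however large its coefficient. -/
theorem le_smul_proj_add_smul_proj_compl {H : BH} (hH : IsSelfAdjoint H) {ε : ℝ} (hε : 0 < ε)
    {A : Set ℕ} (h : SmallOn H ε A) :
    H ≤ (2 * ε) • proj A + (‖H‖ + ‖H‖ ^ 2 / ε) • proj Aᶜ := by
  rw [le_iff_quad hH ((isSelfAdjoint_real_smul (isSelfAdjoint_proj _) _).add
    (isSelfAdjoint_real_smul (isSelfAdjoint_proj _) _))]
  intro x
  rw [quad_add, quad_smul, quad_smul, quad_proj, quad_proj]
  have hx : x = proj A x + proj Aᶜ x := by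
    rw [proj_compl]
    simp
  set u := proj A x with hu
  set v := proj Aᶜ x with hv
  have h1 := (abs_le.1 (h u (supportedOn_proj A x))).2
  have h2 := (abs_le.1 (abs_quad_le H v)).2
  have h3 : quad H x = quad H u + quad H v + 2 * (inner ℂ (H u) v).re := by
    have hsym : inner ℂ (H v) u = inner ℂ v (H u) := hH.isSymmetric v u
    rw [hx, quad, quad, quad, map_add, inner_add_left, inner_add_right, inner_add_right, hsym,
      ← inner_conj_symm v]
    simp only [Complex.add_re, Complex.conj_re]
    ring
  have h4 : (inner ℂ (H u) v).re ≤ ‖H‖ * ‖u‖ * ‖v‖ :=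
    (Complex.re_le_norm _).trans ((norm_inner_le_norm _ _).trans (by
      gcongr; exact H.le_opNorm u))
  have h5 : 2 * (‖H‖ * ‖u‖ * ‖v‖) ≤ ε * ‖u‖ ^ 2 + ‖H‖ ^ 2 / ε * ‖v‖ ^ 2 := by
    have h6 : 0 ≤ ε⁻¹ * (ε * ‖u‖ - ‖H‖ * ‖v‖) ^ 2 := by positivity
    have h7 : ε⁻¹ * (ε * ‖u‖ - ‖H‖ * ‖v‖) ^ 2 =
        ε * ‖u‖ ^ 2 + ‖H‖ ^ 2 / ε * ‖v‖ ^ 2 - 2 * (‖H‖ * ‖u‖ * ‖v‖) := by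
      field_simp
      ring
    linarith
  rw [h3]
  linarith

theorem linearMap_real_smul (t : BH →ₗ[ℂ] ℂ) (c : ℝ) (X : BH) : t (c • X) = c * t X := by
  rw [RCLike.real_smul_eq_coe_smul (K := ℂ) c X]
  exact t.map_smul _ _

theorem state_le_of_smallOn {t : BH →ₗ[ℂ] ℂ} (ht : t ∈ states BH) {A : Set ℕ}
    (hA : t (proj A) = 1) {H : BH} (hH : IsSelfAdjoint H) {ε : ℝ} (hε : 0 < ε)
    (h : SmallOn H ε A) : t H ≤ ((2 * ε : ℝ) : ℂ) := by
  have h1 := ht.2 _ (sub_nonneg.2 (le_smul_proj_add_smul_proj_compl hH hε h))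
  rw [map_sub, map_add, linearMap_real_smul, linearMap_real_smul, proj_compl, map_sub, ht.1, hA, sub_self,
    mul_zero, add_zero, mul_one] at h1
  exact sub_nonneg.1 h1

theorem norm_state_le_of_smallOn {t : BH →ₗ[ℂ] ℂ} (ht : t ∈ states BH) {A : Set ℕ}
    (hA : t (proj A) = 1) {H : BH} (hH : IsSelfAdjoint H) {ε : ℝ} (hε : 0 < ε)
    (h : SmallOn H ε A) : ‖t H‖ ≤ 2 * ε := by
  have h1 := Complex.le_def.1 (state_le_of_smallOn ht hA hH hε h)
  have h2 := Complex.le_def.1 (state_le_of_smallOn ht hA hH.neg hε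
    fun x hx => by rw [quad_neg, abs_neg]; exact h x hx)
  rw [map_neg] at h2
  simp only [Complex.neg_re, Complex.neg_im, Complex.ofReal_re, Complex.ofReal_im] at h1 h2
  have h3 : t H = ((t H).re : ℂ) := Complex.ext rfl (by simpa using h1.2)
  rw [h3, Complex.norm_real, Real.norm_eq_abs, abs_le]
  constructor <;> linarith [h1.1, h2.1]

/-! ### Pure states on the diagonal -/

open Classical in
theorem entry_compress_self (A : Set ℕ) (X : BH) (i : ℕ) :
    entry (proj A * X * proj A) i i = if i ∈ A then entry X i i else 0 := by
  have h : entry (proj A * X * proj A) i i = (proj A (X (proj A (e i)))) i := rfl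
  rw [h, proj_apply]
  split_ifs with hi
  · rw [(supportedOn_e hi).proj_eq]
    rfl
  · rfl

theorem compress_add_compress_compl (A : Set ℕ) (X : D) :
    projD A * X * projD A + projD Aᶜ * X * projD Aᶜ = X := D_ext fun i => by
  have h : entry ((projD A * X * projD A + projD Aᶜ * X * projD Aᶜ : D) : BH) i i =
      entry (proj A * (X : BH) * proj A) i i + entry (proj Aᶜ * (X : BH) * proj Aᶜ) i i := rfl
  rw [h, entry_compress_self, entry_compress_self]
  by_cases hi : i ∈ A <;> simp [hi]

theorem compress_nonneg (A : Set ℕ) {X : BH} (hX : 0 ≤ X) : 0 ≤ proj A * X * proj A := by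
  rw [nonneg_iff_quad] at hX ⊢
  exact ⟨isSelfAdjoint_compress hX.1 A, fun x => by rw [quad_compress]; exact hX.2 _⟩

theorem projD_mul_self (A : Set ℕ) : projD A * projD A = projD A :=
  Subtype.ext (proj_mul_self A)

/-- The functional `X ↦ c⁻¹ s(P_A X P_A)`. -/
def restrictState (s : D →ₗ[ℂ] ℂ) (A : Set ℕ) (c : ℝ) : D →ₗ[ℂ] ℂ :=
  ((c⁻¹ : ℝ) : ℂ) • (s ∘ₗ LinearMap.mulRight ℂ (projD A) ∘ₗ LinearMap.mulLeft ℂ (projD A))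

theorem restrictState_apply (s : D →ₗ[ℂ] ℂ) (A : Set ℕ) (c : ℝ) (X : D) :
    restrictState s A c X = ((c⁻¹ : ℝ) : ℂ) * s (projD A * X * projD A) := rfl

theorem restrictState_mem {s : D →ₗ[ℂ] ℂ} (hs : s ∈ states D) {A : Set ℕ} {c : ℝ} (hc : 0 < c)
    (hA : s (projD A) = c) : restrictState s A c ∈ states D := by
  refine ⟨?_, fun X hX => ?_⟩
  · rw [restrictState_apply, mul_one, projD_mul_self, hA, ← Complex.ofReal_mul,
      inv_mul_cancel₀ hc.ne', Complex.ofReal_one]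
  · rw [restrictState_apply]
    exact mul_nonneg (Complex.zero_le_real.2 (by positivity)) (hs.2 _ (compress_nonneg A hX))

theorem exists_real_state_projD {s : D →ₗ[ℂ] ℂ} (hs : s ∈ states D) (A : Set ℕ) :
    ∃ c : ℝ, s (projD A) = c ∧ s (projD Aᶜ) = ((1 - c : ℝ) : ℂ) ∧ 0 ≤ c ∧ c ≤ 1 := by
  have h1 := Complex.le_def.1 (hs.2 _ (projD_nonneg A))
  have h2 := Complex.le_def.1 (hs.2 _ (projD_nonneg Aᶜ))
  have h3 : s (projD A) = ((s (projD A)).re : ℂ) := Complex.ext rfl (by simpa using h1.2.symm)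
  have h4 : s (projD Aᶜ) = ((1 - (s (projD A)).re : ℝ) : ℂ) := by
    rw [projD_compl, map_sub, hs.1, Complex.ofReal_sub, ← h3, Complex.ofReal_one]
  refine ⟨_, h3, h4, h1.1, ?_⟩
  rw [h4] at h2
  simpa using h2.1

/-- If 0 < c = s(P_A) < 1, then s is a proper convex combination of its normalized restrictions to A
and to the complement. Extremality identifies s with the first, whose value at P_A is 1. -/
theorem pureState_projD {s : D →ₗ[ℂ] ℂ} (hs : s ∈ pureStates D) (A : Set ℕ) :
    s (projD A) = 0 ∨ s (projD A) = 1 := by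
  obtain ⟨hst, hext⟩ := mem_extremePoints.1 hs
  obtain ⟨c, hc, hc', hc0, hc1⟩ := exists_real_state_projD hst A
  rcases hc0.eq_or_lt with h0 | h0
  · left; rw [hc, ← h0, Complex.ofReal_zero]
  rcases hc1.eq_or_lt with h1 | h1
  · right; rw [hc, h1, Complex.ofReal_one]
  have h1' := sub_pos.2 h1
  have hseg : s ∈ openSegment ℝ (restrictState s A c) (restrictState s Aᶜ (1 - c)) := by
    refine ⟨c, 1 - c, h0, h1', by ring, LinearMap.ext fun X => ?_⟩
    have h : ∀ (a : ℝ) (B : Set ℕ), 0 < a →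
        (a • restrictState s B a) X = s (projD B * X * projD B) := fun a B ha => by
      rw [LinearMap.smul_apply, restrictState_apply, Complex.real_smul, ← mul_assoc,
        ← Complex.ofReal_mul, mul_inv_cancel₀ ha.ne', Complex.ofReal_one, one_mul]
    rw [LinearMap.add_apply, h c A h0, h _ Aᶜ h1', ← map_add, compress_add_compress_compl]
  have h2 := (hext _ (restrictState_mem hst h0 hc) _ (restrictState_mem hst h1' hc') hseg).1
  right
  rw [← h2, restrictState_apply, projD_mul_self, projD_mul_self, hc, ← Complex.ofReal_mul,
    inv_mul_cancel₀ h0.ne', Complex.ofReal_one]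

theorem sum_projD {r : ℕ} {A : Fin r → Set ℕ} (hA : IsPaving A) : ∑ i, projD (A i) = 1 := by
  classical
  refine D_ext fun n => ?_
  let φ : D →+ ℂ :=
    { toFun := fun X => entry (X : BH) n n
      map_zero' := rfl
      map_add' := fun _ _ => rfl }
  obtain ⟨i, hi⟩ := Set.mem_iUnion.1 (hA.2 ▸ Set.mem_univ n)
  have h : φ (∑ i, projD (A i)) = 1 := by
    rw [map_sum, Finset.sum_eq_single i]
    · exact (entry_proj _ _).trans (if_pos hi)
    · exact fun j _ hj => (entry_proj _ _).trans
        (if_neg fun hn => Set.disjoint_left.1 (hA.1 hj) hn hi)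
    · exact fun h => absurd (Finset.mem_univ i) h
  exact h.trans (entry_one_self n).symm

theorem exists_state_projD_eq_one {s : D →ₗ[ℂ] ℂ} (hs : s ∈ pureStates D) {r : ℕ}
    {A : Fin r → Set ℕ} (hA : IsPaving A) : ∃ i, s (projD (A i)) = 1 := by
  by_contra! h
  have h1 : s (∑ i, projD (A i)) = 0 := by
    rw [map_sum]
    exact Finset.sum_eq_zero fun i _ => (pureState_projD hs (A i)).resolve_right (h i)
  rw [sum_projD hA, (mem_extremePoints.1 hs).1.1] at h1
  exact one_ne_zero h1

theorem conjecture_of_paving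
    (h : ∀ H : BH, IsSelfAdjoint H → E H = 0 → ∀ ε : ℝ, 0 < ε →
      ∃ (r : ℕ) (A : Fin r → Set ℕ), IsPaving A ∧ ∀ i, SmallOn H ε (A i)) : Conjecture := by
  intro s hs
  have hst := (mem_extremePoints.1 hs).1
  refine ⟨s ∘ₗ linearE, ⟨comp_linearE_mem_states hst, fun X => congrArg s (E_coe X)⟩, ?_⟩
  rintro t ⟨ht, hts⟩
  refine linearMap_ext_selfAdjoint fun X hX => ?_
  have h0 : t (X - E X) = 0 := by
    rw [← norm_le_zero_iff]
    refine le_of_forall_pos_le_add fun ε hε => ?_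
    have hsa := hX.sub (isSelfAdjoint_coe_E hX)
    obtain ⟨r, A, hA, hsmall⟩ := h (X - E X) hsa (E_sub_coe_E X) (ε / 2) (half_pos hε)
    obtain ⟨i, hi⟩ := exists_state_projD_eq_one hs hA
    have := norm_state_le_of_smallOn ht ((hts (projD (A i))).trans hi) hsa (half_pos hε) (hsmall i)
    linarith
  rw [map_sub, sub_eq_zero, hts] at h0
  exact h0

open Filter Topology

/-! ### States concentrated on an ultrafilter -/

theorem exists_tendsto_of_norm_le {ι F : Type*} [NormedAddCommGroup F] [ProperSpace F]
    (V : Ultrafilter ι) {f : ι → F} {C : ℝ} (hf : ∀ i, ‖f i‖ ≤ C) :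
    ∃ z, Tendsto f V (𝓝 z) := by
  obtain ⟨z, -, hz⟩ := (isCompact_closedBall (0 : F) C).ultrafilter_le_nhds (V.map f)
    (le_principal_iff.2 (Ultrafilter.mem_map.2
      (Eventually.of_forall fun i => mem_closedBall_zero_iff.2 (hf i))))
  exact ⟨z, hz⟩

/-- X - l is small on a member of U, so the state bound applies to the extension s ∘ E. Thus a state
concentrated on U is determined by limits along U. -/
theorem state_eq_of_tendsto {U : Ultrafilter ℕ} {s : D →ₗ[ℂ] ℂ} (hs : s ∈ states D)
    (hU : ∀ A ∈ U, s (projD A) = 1) {X : D} (hX : IsSelfAdjoint (X : BH)) {l : ℝ}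
    (hl : Tendsto (fun i => quad X (e i)) U (𝓝 l)) : s X = l := by
  rw [← sub_eq_zero, ← norm_le_zero_iff]
  refine le_of_forall_pos_le_add fun ε hε => ?_
  have hε2 := half_pos hε
  have hsa : IsSelfAdjoint ((X : BH) - l • (1 : BH)) :=
    hX.sub (isSelfAdjoint_real_smul (.one _) l)
  set A : Set ℕ := {i | |quad X (e i) - l| < ε / 2}
  have hA : ∀ i ∈ A, -(ε / 2) < quad X (e i) - l ∧ quad X (e i) - l < ε / 2 :=
    fun i hi => abs_lt.1 hi
  have hAU : A ∈ U := hl.eventually (Metric.ball_mem_nhds l hε2)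
  have hlow : ∀ (Y : D) (m : ℝ), (∀ i ∈ A, m ≤ quad (Y : BH) (e i)) → ∀ x, SupportedOn A x →
      m * ‖x‖ ^ 2 ≤ quad (Y : BH) x := fun Y m hm x hx => by
    rw [← E_coe Y, coe_E]
    exact smul_norm_sq_le_quad_diagOp (fun i hi => by rw [← quad_e]; exact hm i hi) hx
  have hsmall : SmallOn ((X : BH) - l • (1 : BH)) (ε / 2) A := fun x hx => by
    have h1 := hlow X (l - ε / 2) (fun i hi => by linarith [(hA i hi).1]) x hx
    have h2 := hlow (-X) (-(l + ε / 2)) (fun i hi => by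
      have h : quad ((-X : D) : BH) (e i) = -quad (X : BH) (e i) := quad_neg _ _
      rw [h]
      linarith [(hA i hi).2]) x hx
    have h3 : quad ((-X : D) : BH) x = -quad (X : BH) x := quad_neg _ _
    rw [quad_sub, quad_smul, quad_one, abs_le]
    rw [h3] at h2
    constructor <;> linarith
  have hmem := comp_linearE_mem_states hs
  have hval : ∀ Y : D, (s ∘ₗ linearE) (Y : BH) = s Y := fun Y => congrArg s (E_coe Y)
  have h4 := norm_state_le_of_smallOn hmem ((hval (projD A)).trans (hU A hAU)) hsa hε2 hsmall
  rw [map_sub, linearMap_real_smul, hmem.1, hval, mul_one] at h4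
  linarith

/-- Since 1 is the maximum of a state on a projection, both ends of a segment through s are also
concentrated on U, hence agree with s. -/
theorem mem_pureStates_of_ultrafilter {U : Ultrafilter ℕ} {s : D →ₗ[ℂ] ℂ} (hs : s ∈ states D)
    (hU : ∀ A ∈ U, s (projD A) = 1) : s ∈ pureStates D := by
  refine mem_extremePoints_iff_left.2 ⟨hs, fun s₁ h₁ s₂ h₂ hseg => ?_⟩
  obtain ⟨a, b, ha, hb, hab, hs'⟩ := hseg
  have hU₁ : ∀ A ∈ U, s₁ (projD A) = 1 := fun A hA => by
    obtain ⟨c₁, hc₁, -, -, hc₁'⟩ := exists_real_state_projD h₁ A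
    obtain ⟨c₂, hc₂, -, -, hc₂'⟩ := exists_real_state_projD h₂ A
    have h := hU A hA
    rw [← hs', LinearMap.add_apply, LinearMap.smul_apply, LinearMap.smul_apply, hc₁, hc₂,
      Complex.real_smul, Complex.real_smul] at h
    have h' : a * c₁ + b * c₂ = 1 := by exact_mod_cast h
    have : c₁ = 1 := by
      refine le_antisymm hc₁' ?_
      by_contra! hlt
      nlinarith
    rw [hc₁, this, Complex.ofReal_one]
  refine linearMap_ext_selfAdjoint fun X hX => ?_
  have hX' : IsSelfAdjoint (X : BH) := congrArg (fun Y : D => (Y : BH)) hX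
  obtain ⟨l, hl⟩ := exists_tendsto_of_norm_le U (f := fun i => quad (X : BH) (e i)) (C := ‖(X : BH)‖)
    fun i => by simpa [norm_e] using abs_quad_le (X : BH) (e i)
  rw [state_eq_of_tendsto h₁ hU₁ hX' hl, state_eq_of_tendsto hs hU hX' hl]

theorem exists_limit_state {ι : Type*} (V : Ultrafilter ι) {ξ : ι → H2} (hξ : ∀ i, ‖ξ i‖ = 1) :
    ∃ t ∈ states BH, ∀ X, Tendsto (fun i => inner ℂ (ξ i) (X (ξ i))) V (𝓝 (t X)) := by
  have hlim : ∀ X : BH, ∃ z, Tendsto (fun i => inner ℂ (ξ i) (X (ξ i))) V (𝓝 z) := fun X =>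
    exists_tendsto_of_norm_le V (C := ‖X‖) fun i => by
      refine (norm_inner_le_norm _ _).trans ?_
      simpa [hξ i] using X.le_opNorm (ξ i)
  choose L hL using hlim
  let t : BH →ₗ[ℂ] ℂ :=
    { toFun := L
      map_add' := fun X Y => tendsto_nhds_unique (hL (X + Y)) <| by
        simpa only [add_apply, inner_add_right] using (hL X).add (hL Y)
      map_smul' := fun c X => tendsto_nhds_unique (hL (c • X)) <| by
        simpa only [smul_apply, inner_smul_right] using! (hL X).const_mul c }
  refine ⟨t, ⟨tendsto_nhds_unique (hL 1) ?_, fun X hX => ?_⟩, hL⟩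
  · refine tendsto_const_nhds.congr fun i => ?_
    rw [one_apply_eq_self, inner_self_eq_norm_sq_to_K, hξ]
    simp
  · exact ge_of_tendsto' (hL X) fun i =>
      ((ContinuousLinearMap.nonneg_iff_isPositive X).1 hX).inner_nonneg_right _

/-- Complements of small sets generate a proper filter: otherwise finitely many small sets would
cover ℕ, and smallness passes to subsets, giving a paving. -/
theorem exists_ultrafilter_forall_not_smallOn {H : BH} {ε : ℝ}
    (h : ¬ ∃ (r : ℕ) (A : Fin r → Set ℕ), IsPaving A ∧ ∀ i, SmallOn H ε (A i)) :
    ∃ U : Ultrafilter ℕ, ∀ A ∈ U, ¬ SmallOn H ε A := by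
  have hne : (generate {B | SmallOn H ε Bᶜ}).NeBot := by
    refine generate_neBot_iff.2 fun T hT hfin => ?_
    by_contra hemp
    rw [Set.not_nonempty_iff_eq_empty] at hemp
    have hcover : ⋃ B : T, (B : Set ℕ)ᶜ = Set.univ := by
      rw [← Set.compl_iInter, ← Set.sInter_eq_iInter, hemp, Set.compl_empty]
    obtain ⟨f, hf⟩ := exists_coloring_of_iUnion_eq_univ hcover
    have := hfin.to_subtype
    obtain ⟨r, A, hA, hfib⟩ := exists_paving_of_coloring f
    refine h ⟨r, A, hA, fun i => ?_⟩
    obtain ⟨B, hB⟩ := hfib i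
    have hsB : SmallOn H ε (B : Set ℕ)ᶜ := hT B.2
    exact hsB.mono (hB ▸ hf B)
  refine ⟨Ultrafilter.of (generate {B | SmallOn H ε Bᶜ}), fun A hA hsmall => ?_⟩
  have hAc : Aᶜ ∈ Ultrafilter.of (generate {B | SmallOn H ε Bᶜ}) :=
    Ultrafilter.of_le _ (mem_generate_of_mem (by simpa using hsmall))
  exact Ultrafilter.compl_notMem_iff.2 hA hAc

theorem exists_unit_vector_of_not_smallOn {H : BH} {ε : ℝ} {A : Set ℕ} (h : ¬ SmallOn H ε A) :
    ∃ x, ‖x‖ = 1 ∧ SupportedOn A x ∧ ε < |quad H x| := by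
  simp only [SmallOn, not_forall, not_le] at h
  obtain ⟨x, hx, hlt⟩ := h
  have hx0 : ‖x‖ ≠ 0 := fun h0 => by
    have h1 := abs_quad_le H x
    simp only [h0, ne_eq, OfNat.ofNat_ne_zero, not_false_eq_true, zero_pow, mul_zero] at h1 hlt
    linarith
  have hxp : 0 < ‖x‖ := lt_of_le_of_ne (norm_nonneg _) hx0.symm
  refine ⟨((‖x‖⁻¹ : ℝ) : ℂ) • x, ?_, hx.smul _, ?_⟩
  · rw [norm_smul, Complex.norm_real, norm_inv, norm_norm, inv_mul_cancel₀ hx0]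
  · rw [quad_smul_vec, Complex.norm_real, norm_inv, norm_norm, abs_mul, abs_sq, inv_pow,
      inv_mul_eq_div, lt_div_iff₀ (by positivity)]
    exact hlt

theorem paving_of_conjecture (h : Conjecture) {H : BH} (hE : E H = 0)
    {ε : ℝ} (hε : 0 < ε) :
    ∃ (r : ℕ) (A : Fin r → Set ℕ), IsPaving A ∧ ∀ i, SmallOn H ε (A i) := by
  by_contra hcon
  obtain ⟨U, hU⟩ := exists_ultrafilter_forall_not_smallOn hcon
  have : Nonempty {A : Set ℕ // A ∈ U} := ⟨⟨Set.univ, univ_mem⟩⟩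
  have : IsCodirectedOrder {A : Set ℕ // A ∈ U} :=
    ⟨fun A B => ⟨⟨A.1 ∩ B.1, inter_mem A.2 B.2⟩, Set.inter_subset_left, Set.inter_subset_right⟩⟩
  choose ξ hξ hsupp hlt using fun A : {A : Set ℕ // A ∈ U} =>
    exists_unit_vector_of_not_smallOn (hU A.1 A.2)
  -- Members of U are directed downward by inclusion; V refines the filter of ever smaller members,
  -- so the chosen vectors are eventually supported in each A ∈ U.
  set V : Ultrafilter {A : Set ℕ // A ∈ U} := Ultrafilter.of atBot
  obtain ⟨t, ht, hlim⟩ := exists_limit_state V hξ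
  set s : D →ₗ[ℂ] ℂ := t ∘ₗ D.toSubalgebra.toSubmodule.subtype with hs
  have hsX : ∀ X : D, s X = t (X : BH) := fun X => rfl
  have hst : s ∈ states D := ⟨ht.1, fun X hX => ht.2 _ hX⟩
  have hsU : ∀ A ∈ U, s (projD A) = 1 := fun A hA => by
    refine tendsto_nhds_unique (hlim (proj A)) (tendsto_const_nhds.congr' ?_)
    have hev : ∀ᶠ B : {A : Set ℕ // A ∈ U} in V, B ≤ ⟨A, hA⟩ :=
      Ultrafilter.of_le _ (eventually_le_atBot _)
    filter_upwards [hev] with B hB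
    rw [((hsupp B).mono hB).proj_eq, inner_self_eq_norm_sq_to_K, hξ]
    simp
  obtain ⟨_, -, huniq⟩ := h s (mem_pureStates_of_ultrafilter hst hsU)
  have heq : t = s ∘ₗ linearE :=
    (huniq t ⟨ht, fun _ => rfl⟩).trans
      (huniq _ ⟨comp_linearE_mem_states hst, fun X => congrArg s (E_coe X)⟩).symm
  have ht0 : t H = 0 := by
    rw [heq, LinearMap.comp_apply, linearE_apply, hE, map_zero]
  -- The lower bound on the quadratic form survives the limit, whereas s ∘ E vanishes at H.
  have hge : ε ≤ ‖t H‖ := ge_of_tendsto' (hlim H).norm fun A => by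
    rw [← norm_inner_symm]
    exact (hlt A).le.trans (Complex.abs_re_le_norm _)
  rw [ht0, norm_zero] at hge
  linarith

end KadisonSinger

end

/-! ### Assembly of the equivalences -/

theorem mainTheorem4 (a b : ℝ) (ha : 0 < a) (ha1 : a < 1) (hb : 1 < b) :
    List.TFAE [
      KadisonSinger.Conjecture,
      ∀ H : KadisonSinger.BH, IsSelfAdjoint H → KadisonSinger.E H = 0 → ∀ ε : ℝ, 0 < ε →
        ∃ (r : ℕ) (A : Fin r → Set ℕ), KadisonSinger.IsPaving A ∧ ∀ i,
          -(ε • KadisonSinger.proj (A i)) ≤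
              KadisonSinger.proj (A i) * H * KadisonSinger.proj (A i) ∧
            KadisonSinger.proj (A i) * H * KadisonSinger.proj (A i) ≤
              ε • KadisonSinger.proj (A i),
      ∀ ε : ℝ, 0 < ε → ∃ r : ℕ,
        ∀ H : KadisonSinger.BH, IsSelfAdjoint H → KadisonSinger.E H = 0 →
          ∃ A : Fin r → Set ℕ, KadisonSinger.IsPaving A ∧ ∀ i,
            ‖KadisonSinger.proj (A i) * H * KadisonSinger.proj (A i)‖ ≤ ε * ‖H‖,
      ∀ P : KadisonSinger.BH, 0 ≤ P → IsUnit P → ∀ ε : ℝ, 0 < ε →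
        ∃ (r : ℕ) (A : Fin r → Set ℕ),
          KadisonSinger.IsPaving A ∧ KadisonSinger.PavesPositive A P ε,
      ∀ P ∈ KadisonSinger.PInterval a b, ∀ ε : ℝ, 0 < ε →
        ∃ (r : ℕ) (A : Fin r → Set ℕ),
          KadisonSinger.IsPaving A ∧ KadisonSinger.PavesPositive A P ε,
      ∀ ε : ℝ, 0 < ε → ∃ r : ℕ, ∀ P ∈ KadisonSinger.PInterval a b,
        ∃ A : Fin r → Set ℕ,
          KadisonSinger.IsPaving A ∧ KadisonSinger.PavesPositive A P ε] := by
  have hsmall : (∀ H : KadisonSinger.BH, IsSelfAdjoint H → KadisonSinger.E H = 0 →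
      ∀ ε : ℝ, 0 < ε → ∃ (r : ℕ) (A : Fin r → Set ℕ), KadisonSinger.IsPaving A ∧ ∀ i,
        -(ε • KadisonSinger.proj (A i)) ≤
            KadisonSinger.proj (A i) * H * KadisonSinger.proj (A i) ∧
          KadisonSinger.proj (A i) * H * KadisonSinger.proj (A i) ≤
            ε • KadisonSinger.proj (A i)) ↔
      ∀ H : KadisonSinger.BH, IsSelfAdjoint H → KadisonSinger.E H = 0 → ∀ ε : ℝ, 0 < ε →
        ∃ (r : ℕ) (A : Fin r → Set ℕ), KadisonSinger.IsPaving A ∧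
          ∀ i, KadisonSinger.SmallOn H ε (A i) := by
    refine forall_congr' fun H => forall_congr' fun hH => ?_
    simp only [KadisonSinger.smallOn_iff hH]
  rw [hsmall]
  tfae_have 1 → 2 := fun h H _ hE ε hε => KadisonSinger.paving_of_conjecture h hE hε
  tfae_have 2 → 1 := KadisonSinger.conjecture_of_paving
  tfae_have 2 → 3 := fun h ε hε => by
    obtain ⟨r, hr⟩ := KadisonSinger.uniform_paving_of_paving h hε
    refine ⟨r, fun H hH hE => ?_⟩
    obtain ⟨A, hA, hAs⟩ := hr H hH hE
    exact ⟨A, hA, fun i => (hAs i).norm_compress_le hH (by positivity)⟩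
  tfae_have 3 → 2 := fun h H hH hE ε hε => by
    -- Adding 1 avoids dividing by zero when H = 0.
    obtain ⟨r, hr⟩ := h (ε / (‖H‖ + 1)) (by positivity)
    obtain ⟨A, hA, hAs⟩ := hr H hH hE
    refine ⟨r, A, hA, fun i => KadisonSinger.smallOn_of_norm_compress_le ((hAs i).trans ?_)⟩
    rw [div_mul_eq_mul_div, div_le_iff₀ (by positivity)]
    gcongr
    linarith
  tfae_have 2 → 4 := fun h P hP hu ε hε => KadisonSinger.positive_paving_of_paving h hP hu hε
  tfae_have 4 → 5 := fun h P hP => h P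
    (KadisonSinger.nonneg_iff_quad.2 ⟨(KadisonSinger.mem_PInterval_iff.1 hP).1, fun x =>
      ((KadisonSinger.mem_PInterval_iff.1 hP).2 x).1.trans' (by positivity)⟩)
    (KadisonSinger.isUnit_of_mem_PInterval ha hP)
  tfae_have 5 → 2 := fun h H hH hE ε hε =>
    KadisonSinger.paving_of_positive_paving ha ha1 hb h hH hE hε
  tfae_have 5 → 6 := fun h ε hε =>
    KadisonSinger.uniform_positive_paving_of_positive_paving ha (by linarith)
      fun P hP => h P hP ε hε
  tfae_have 6 → 5 := fun h P hP ε hε => by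
    obtain ⟨r, hr⟩ := h ε hε
    exact ⟨r, hr P hP⟩
  tfae_finish
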